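/- Let $n\ge 1$, let $c_n$ be the volume of the unit ball of $\mathbb R^n$, and let $\chi_r$ denote the indicator function of the ball $B(0,r)\subset\mathbb R^n$. **Potential.** Let $W\in C^\infty(\mathbb R^n\setminus\{0\})$ be real-valued and radially symmetric, $W(x)=W(r)$ with $r=|x|$, and attractive: $W'(r)>0$ for all $r>0$. Assume that $W$ is no more singular at the origin than some locally integrable Riesz potential: there are $k>-n$ and $C>0$ with $W'(r)\le C\,r^{k-1}$ for all $r\in(0,1)$. For a density $\rho$ put $$\mathcal I[\rho]=\frac12\int_{\mathbb R^n}\rho\,(W*\rho)\,dx=\frac12\int_{\mathbb R^n}\int_{\mathbb R^n}\rho(x)\,W(x-y)\,\rho(y)\,dy\,dx .$$ **Height function.** For a bounded radially decreasing probability density $\rho$ on $\mathbb R^n$ (decreasing in the non-strict sense), its height function $h$ is defined for $s\in(0,1)$ by letting $h(s)>0$ be the unique number with $\int_{\mathbb R^n}\min\{\rho(x),h(s)\}\,dx=s$. **Interpolation.** Let $\rho_0\ne\rho_1$ be continuous radially decreasing probability densities on $\mathbb R^n$ with height functions $h_0,h_1$. For $t\in[0,1]$ let $h_t=(1-t)h_0+t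 h_1$ and $$\rho_t(x)=\int_0^1\chi_{(c_n h_t'(s))^{-1/n}}(x)\,h_t'(s)\,ds .$$ **Proposition.** For every $t\in[0,1]$ the negative part of $\rho_t(x)W(x-y)\rho_t(y)$ is integrable on $\mathbb R^n\times\mathbb R^n$, so that $\mathcal I[\rho_t]\in(-\infty,+\infty]$ is well defined, and $t\mapsto\mathcal I[\rho_t]$ is strictly convex where it is finite: the set $D=\{t\in[0,1]:\mathcal I[\rho_t]<\infty\}$ is convex, and $$\mathcal I[\rho_{(1-\theta)a+\theta b}]<(1-\theta)\,\mathcal I[\rho_a]+\theta\,\mathcal I[\rho_b]\qquad\text{for all } a\ne b \text{ in } D,\ \theta\in(0,1).$$ In particular, if the energy is finite at $t=0$ and $t=1$, then $t\mapsto\mathcal I[\rho_t]$ is strictly convex on $[0,1]$. -/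

import Mathlib

open MeasureTheory Set
open scoped ContDiff

/-- `ℝⁿ` with its Euclidean norm and Lebesgue measure. -/
abbrev Space (n : ℕ) : Type := EuclideanSpace ℝ (Fin n)

/-- `ρ` is a probability density on `ℝⁿ`. -/
structure IsProbDensity {n : ℕ} (ρ : Space n → ℝ) : Prop where
  nonneg : ∀ x, 0 ≤ ρ x
  integrable : Integrable ρ
  integral_eq_one : ∫ x, ρ x = 1

/-- `ρ` is radially symmetric and non-increasing in the radial variable (plateaus are allowed;
taking `‖x‖ = ‖y‖` gives the symmetry). -/
def RadiallyDecreasing {n : ℕ} (ρ : Space n → ℝ) : Prop :=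
  ∀ x y : Space n, ‖x‖ ≤ ‖y‖ → ρ y ≤ ρ x

/-- `W` is a smooth attractive potential on `ℝⁿ \ {0}` with radial profile `w`, that is,
`W x = w |x|` and `w'(r) > 0` for `r > 0`. The value `W 0` is irrelevant. -/
structure IsAttractivePotential {n : ℕ} (W : Space n → ℝ) (w : ℝ → ℝ) : Prop where
  smooth : ContDiffOn ℝ ∞ W {0}ᶜ
  radial : ∀ x : Space n, x ≠ 0 → W x = w ‖x‖
  deriv_pos : ∀ r : ℝ, 0 < r → 0 < deriv w r

/-- The profile `w` is no more singular at the origin than some locally integrable Riesz potential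
`|x|^k / k` on `ℝⁿ`, `k > -n`. -/
def NoMoreSingularThanRiesz (n : ℕ) (w : ℝ → ℝ) : Prop :=
  ∃ k C : ℝ, -(n : ℝ) < k ∧ 0 < C ∧ ∀ r : ℝ, 0 < r → r < 1 → deriv w r ≤ C * r ^ (k - 1)

/-- The interaction energy `I[ρ] = 1/2 ∫ ρ (W * ρ)`. -/
noncomputable def interactionEnergy {n : ℕ} (W : Space n → ℝ) (ρ : Space n → ℝ) : ℝ :=
  (1 / 2) * ∫ x, ρ x * ∫ y, W (x - y) * ρ y

/-- The interaction energy of `ρ` is finite: its integrand is integrable on `ℝⁿ × ℝⁿ`. -/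
def HasFiniteEnergy {n : ℕ} (W : Space n → ℝ) (ρ : Space n → ℝ) : Prop :=
  Integrable (fun p : Space n × Space n => ρ p.1 * W (p.1 - p.2) * ρ p.2)

/-- The negative part of the integrand of the interaction energy is integrable, so that the
energy is well defined as an element of `(-∞, +∞]`. -/
def EnergyWellDefined {n : ℕ} (W : Space n → ℝ) (ρ : Space n → ℝ) : Prop :=
  Integrable (fun p : Space n × Space n => max (-(ρ p.1 * W (p.1 - p.2) * ρ p.2)) 0)

/-- The height function of `ρ` with respect to mass: for `0 < s < 1`, the unique `η > 0` with
`∫ min (ρ x) η dx = s`. For a probability density the set below is then a singleton, and `sInf`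
picks its element. -/
noncomputable def heightFunction {n : ℕ} (ρ : Space n → ℝ) (s : ℝ) : ℝ :=
  sInf {η : ℝ | 0 < η ∧ ∫ x, min (ρ x) η = s}

/-- The volume `c_n` of the unit ball of `ℝⁿ`. -/
noncomputable def unitBallVolume (n : ℕ) : ℝ :=
  volume.real (Metric.ball (0 : Space n) 1)

/-- The density with height function `h`:
`x ↦ ∫_0^1 χ_{(c_n h'(s))^{-1/n}}(x) h'(s) ds`, where `χ_r` is the indicator of the ball `B(0, r)`.
(`h` is differentiable a.e. on `(0, 1)`, being convex there.) -/
noncomputable def densityOfHeight (n : ℕ) (h : ℝ → ℝ) (x : Space n) : ℝ :=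
  ∫ s in Ioo (0 : ℝ) 1,
    (Metric.ball (0 : Space n) ((unitBallVolume n * deriv h s) ^ (-1 / (n : ℝ)))).indicator
      (fun _ => deriv h s) x

/-- The interpolation curve `ρ_t` between `ρ₀` and `ρ₁`: the density whose height function is the
linear interpolation `(1 - t) h₀ + t h₁` of the height functions of `ρ₀` and `ρ₁`. -/
noncomputable def heightInterpolation {n : ℕ} (ρ₀ ρ₁ : Space n → ℝ) (t : ℝ) : Space n → ℝ :=
  densityOfHeight n (fun s => (1 - t) * heightFunction ρ₀ s + t * heightFunction ρ₁ s)

/-!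
The proof reduces the convexity of the energy to the concavity of one geometric quantity.

**Reduction to balls.** Since `w' > 0`, the layer-cake formula
`w r - w 1 = ∫_0^∞ w'(u) (1_{u ≤ r} - 1_{u ≤ 1}) du` writes the energy of a probability density `ρ` as
a constant minus a superposition, with the positive weights `w'(u) / 2`, of the masses `pairMass ρ u`
that `ρ ⊗ ρ` gives to the pairs at distance less than `u` (normalised for large `u`); see
`hasFiniteEnergy_iff` and `interactionEnergy_eq`. The singularity assumption makes the contribution of
`u ≤ 1` finite for bounded densities. The density with height function `h` is a superposition over
`s ∈ (0, 1)` of uniform probability densities of height `h'(s)` on balls, and `h'` depends affinely on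
the time. So it suffices that for `X`, `Y` uniform in the balls of volumes `1 / a` and `1 / b`,
the probability of `‖X - Y‖ < u` is jointly concave in the heights `(a, b)`.

**Concavity.** Let `c` be the reciprocal of the volume of the ball of radius `u`. Then `c` times this
probability is a symmetric function of `(a, b, c)`, `ballOverlap n a b c`, and it equals the minimum
over `θ₁ + θ₂ + θ₃ = π`, `θᵢ ≥ 0`, of `a q(θ₁) + b q(θ₂) + c q(θ₃)` (`capSum`), where `q(θ)` is the
proportion of the unit ball in a cap of angular radius `θ`. A minimum of linear functions is concave.
To see the identity, let `R₁, R₂, R₃` be the radii of the balls of volumes `1 / a, 1 / b, 1 / c`.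
If these are the sides of a triangle with angles `θ₁, θ₂, θ₃`, split the set of pairs
`‖x‖ < R₁, ‖y‖ < R₂, ‖x - y‖ < R₃` into three cones according to which of `‖x‖ / R₁`, `‖y‖ / R₂`,
`‖x - y‖ / R₃` is the largest. The base of each cone is a lens, which the radical hyperplane cuts into
two caps with angular radii among the `θᵢ` (`volume_real_tripleSet`). Hence equality holds at the angles
of the triangle (`ballOverlap_eq_capSum`). As `q' ∝ sin^n`, the critical point equation of `capSum` is
`a sin^n θ₁ = b sin^n θ₂ = c sin^n θ₃`, which is the law of sines, so the minimum is attained at these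
angles or on the boundary of the simplex, where `capSum` is at least the smallest of `a, b, c`, a
trivial upper bound for `ballOverlap` (`ballOverlap_le_capSum`). If the triangle inequalities
fail, `ballOverlap` is equal to the smallest of `a, b, c`.

**Strictness.** The law of sines determines `(a, b)` from the angles and `c`, so concavity is strict
where the triangle is nondegenerate (`ballOverlap_strictConcave`). As `ρ₀ ≠ ρ₁`, the slopes of the
height functions differ on a set of positive measure (`eq_of_deriv_heightFunction_ae_eq`), and pairs of
layers with comparable radii in this set give nondegenerate triangles for an interval of values of `u`
(`exists_pairMass_strictConcave`).
-/

/-! ### Caps of balls -/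

/-- The unnormalised volume `∫_0^θ sin^n` of the cap of angular radius `θ` of the unit ball of
`ℝⁿ`. The dimension of the cross-sections contributes a power `n - 1`, the change of variables
`t = cos φ` one more. -/
noncomputable def capIntegral (n : ℕ) (θ : ℝ) : ℝ := ∫ φ in (0 : ℝ)..θ, Real.sin φ ^ n

/-- The proportion of the volume of a ball of `ℝⁿ` that lies in a cap of angular radius `θ`. -/
noncomputable def capFraction (n : ℕ) (θ : ℝ) : ℝ := capIntegral n θ / capIntegral n Real.pi

lemma capIntegral_pi_pos (n : ℕ) : 0 < capIntegral n Real.pi := by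
  unfold capIntegral
  refine intervalIntegral.intervalIntegral_pos_of_pos_on
    (Continuous.intervalIntegrable (by fun_prop) _ _) ?_ Real.pi_pos
  intro x hx
  exact pow_pos (Real.sin_pos_of_pos_of_lt_pi hx.1 hx.2) n

lemma capFraction_zero (n : ℕ) : capFraction n 0 = 0 := by
  simp [capFraction, capIntegral]

lemma capFraction_pi (n : ℕ) : capFraction n Real.pi = 1 :=
  div_self (capIntegral_pi_pos n).ne'

lemma hasDerivAt_capFraction (n : ℕ) (θ : ℝ) :
    HasDerivAt (capFraction n) (Real.sin θ ^ n / capIntegral n Real.pi) θ := by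
  unfold capFraction
  refine HasDerivAt.div_const ?_ _
  unfold capIntegral
  have hc : Continuous fun φ : ℝ => Real.sin φ ^ n := by fun_prop
  exact intervalIntegral.integral_hasDerivAt_right (hc.intervalIntegrable _ _)
    (hc.stronglyMeasurableAtFilter _ _) hc.continuousAt

lemma continuous_capFraction (n : ℕ) : Continuous (capFraction n) :=
  continuous_iff_continuousAt.2 fun θ => (hasDerivAt_capFraction n θ).continuousAt

lemma capFraction_pi_sub (n : ℕ) (θ : ℝ) :
    capFraction n (Real.pi - θ) = 1 - capFraction n θ := by
  have hc : Continuous fun φ : ℝ => Real.sin φ ^ n := by fun_prop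
  have h : capIntegral n (Real.pi - θ) = capIntegral n Real.pi - capIntegral n θ := by
    have h1 : ∫ φ in (0 : ℝ)..(Real.pi - θ), Real.sin φ ^ n
        = ∫ φ in θ..Real.pi, Real.sin φ ^ n := by
      have := intervalIntegral.integral_comp_sub_left (a := θ) (b := Real.pi)
        (fun φ : ℝ => Real.sin φ ^ n) Real.pi
      simp only [Real.sin_pi_sub, sub_self] at this
      exact this.symm
    unfold capIntegral
    rw [h1, intervalIntegral.integral_interval_sub_left (hc.intervalIntegrable _ _)
      (hc.intervalIntegrable _ _)]
  unfold capFraction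
  rw [h, sub_div, div_self (capIntegral_pi_pos n).ne']

lemma capFraction_mono {n : ℕ} {θ θ' : ℝ} (h0 : 0 ≤ θ) (h : θ ≤ θ') (hπ : θ' ≤ Real.pi) :
    capFraction n θ ≤ capFraction n θ' := by
  have hc : Continuous fun φ : ℝ => Real.sin φ ^ n := by fun_prop
  refine div_le_div_of_nonneg_right ?_ (capIntegral_pi_pos n).le
  unfold capIntegral
  rw [← sub_nonneg, intervalIntegral.integral_interval_sub_left (hc.intervalIntegrable _ _)
      (hc.intervalIntegrable _ _)]
  refine intervalIntegral.integral_nonneg h fun x hx => ?_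
  exact pow_nonneg (Real.sin_nonneg_of_nonneg_of_le_pi (h0.trans hx.1) (hx.2.trans hπ)) n

lemma integral_sqrt_one_sub_sq_pow (m : ℕ) {θ : ℝ} (h0 : 0 ≤ θ) (hπ : θ ≤ Real.pi) :
    ∫ t in (Real.cos θ)..1, √(1 - t ^ 2) ^ m = capIntegral (m + 1) θ := by
  have h := intervalIntegral.integral_comp_mul_deriv (a := θ) (b := 0) (f := Real.cos)
    (f' := fun x => -Real.sin x) (g := fun t : ℝ => √(1 - t ^ 2) ^ m)
    (fun x _ => Real.hasDerivAt_cos x) (by fun_prop) (by fun_prop)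
  rw [Real.cos_zero] at h
  rw [← h, intervalIntegral.integral_symm, capIntegral, ← intervalIntegral.integral_neg]
  refine intervalIntegral.integral_congr fun x hx => ?_
  rw [uIcc_of_le h0] at hx
  have hs : 0 ≤ Real.sin x := Real.sin_nonneg_of_nonneg_of_le_pi hx.1 (hx.2.trans hπ)
  have : √(1 - Real.cos x ^ 2) = Real.sin x := by
    rw [← Real.sin_sq, Real.sqrt_sq hs]
  simp only [Function.comp, this]
  ring

lemma norm_sq_space_succ {m : ℕ} (y : Space (m + 1)) :
    ‖y‖ ^ 2 = y 0 ^ 2 + ‖(WithLp.toLp 2 fun i : Fin m => y i.succ : Space m)‖ ^ 2 := by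
  rw [EuclideanSpace.norm_sq_eq, EuclideanSpace.norm_sq_eq, Fin.sum_univ_succ]
  simp

/-- Splitting off the first coordinate preserves Lebesgue measure. -/
lemma measurePreserving_split_first (m : ℕ) :
    MeasurePreserving (fun y : Space (m + 1) =>
      (y 0, (WithLp.toLp 2 fun i : Fin m => y i.succ : Space m))) volume volume := by
  have h1 := EuclideanSpace.volume_preserving_symm_measurableEquiv_toLp (Fin (m + 1))
  have h2 := volume_preserving_piFinSuccAbove (fun _ : Fin (m + 1) => ℝ) 0
  have h3 := (EuclideanSpace.volume_preserving_symm_measurableEquiv_toLp (Fin m)).symm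
  exact ((MeasurePreserving.id (volume : Measure ℝ)).prod h3).comp (h2.comp h1)

lemma volume_real_unit_cap_first (m : ℕ) {θ : ℝ} (h0 : 0 ≤ θ) (hπ : θ ≤ Real.pi) :
    volume.real {y : Space (m + 1) | ‖y‖ ≤ 1 ∧ Real.cos θ ≤ y 0}
      = unitBallVolume m * capIntegral (m + 1) θ := by
  set B : Set (ℝ × Space m) := {p | p.1 ^ 2 + ‖p.2‖ ^ 2 ≤ 1 ∧ Real.cos θ ≤ p.1} with hB
  have hBm : MeasurableSet B := by
    have : IsClosed B := by
      rw [hB, ofPred_and]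
      exact (isClosed_le (by fun_prop) (by fun_prop)).inter
        (isClosed_le (by fun_prop) (by fun_prop))
    exact this.measurableSet
  have hpre : {y : Space (m + 1) | ‖y‖ ≤ 1 ∧ Real.cos θ ≤ y 0}
      = (fun y : Space (m + 1) =>
      (y 0, (WithLp.toLp 2 fun i : Fin m => y i.succ : Space m))) ⁻¹' B := by
    ext y
    simp only [hB, mem_ofPred_eq, mem_preimage, ← norm_sq_space_succ]
    rw [sq_le_one_iff₀ (norm_nonneg _)]
  have hvol : volume B = ∫⁻ t in Icc (Real.cos θ) 1,
      ENNReal.ofReal (√(1 - t ^ 2) ^ m) * volume (Metric.ball (0 : Space m) 1) := by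
    rw [Measure.volume_eq_prod, Measure.prod_apply hBm, ← lintegral_indicator measurableSet_Icc]
    refine lintegral_congr fun t => ?_
    by_cases ht : t ∈ Icc (Real.cos θ) 1
    · rw [indicator_of_mem ht]
      have hnn : 0 ≤ 1 - t ^ 2 := by
        nlinarith [ht.1, ht.2, Real.neg_one_le_cos θ]
      have : Prod.mk t ⁻¹' B = Metric.closedBall (0 : Space m) √(1 - t ^ 2) := by
        ext z
        simp only [hB, mem_preimage, mem_ofPred_eq, ht.1, and_true, Metric.mem_closedBall,
          dist_zero_right]
        rw [Real.le_sqrt (norm_nonneg _) hnn]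
        constructor <;> intro h <;> linarith
      rw [this, Measure.addHaar_closedBall _ _ (Real.sqrt_nonneg _), finrank_euclideanSpace,
        Fintype.card_fin]
    · rw [indicator_of_notMem ht]
      have : Prod.mk t ⁻¹' B = ∅ := by
        ext z
        simp only [hB, mem_preimage, mem_ofPred_eq, mem_empty_iff_false, iff_false, not_and]
        intro h1 h2
        refine ht ⟨h2, ?_⟩
        nlinarith [sq_nonneg ‖z‖]
      rw [this, measure_empty]
  have hcos : Real.cos θ ≤ 1 := Real.cos_le_one θ
  rw [Measure.real, hpre, (measurePreserving_split_first m).measure_preimage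
    hBm.nullMeasurableSet, hvol, lintegral_mul_const _ (by fun_prop), ENNReal.toReal_mul,
    ← ofReal_integral_eq_lintegral_ofReal, ENNReal.toReal_ofReal,
    integral_Icc_eq_integral_Ioc, ← intervalIntegral.integral_of_le hcos,
    integral_sqrt_one_sub_sq_pow m h0 hπ, mul_comm]
  · rfl
  · exact integral_nonneg fun t => by positivity
  · exact (Continuous.integrableOn_Icc (by fun_prop))
  · exact Filter.Eventually.of_forall fun t => by positivity

lemma unitBallVolume_pos (n : ℕ) : 0 < unitBallVolume n :=
  ENNReal.toReal_pos (Metric.measure_ball_pos _ _ one_pos).ne' measure_ball_lt_top.ne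

/-- Two unit vectors are related by a measure preserving linear isometry. -/
lemma exists_linearIsometryEquiv_map_eq {n : ℕ} {e e' : Space n} (h : ‖e‖ = ‖e'‖) :
    ∃ f : Space n ≃ₗᵢ[ℝ] Space n, f e = e' :=
  ⟨(ℝ ∙ (e - e'))ᗮ.reflection, Submodule.reflection_sub h⟩

open scoped Pointwise in
/-- The volume of a cap of angular radius `θ` around the direction `e`. -/
lemma volume_real_cap {n : ℕ} (hn : 1 ≤ n) {e : Space n} (he : ‖e‖ = 1) {R θ : ℝ} (hR : 0 < R)
    (h0 : 0 ≤ θ) (hπ : θ ≤ Real.pi) :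
    volume.real {y : Space n | ‖y‖ ≤ R ∧ R * Real.cos θ ≤ inner ℝ e y}
      = unitBallVolume n * R ^ n * capFraction n θ := by
  obtain ⟨m, rfl⟩ : ∃ m, n = m + 1 := ⟨n - 1, by omega⟩
  have hunit : ∀ θ : ℝ, 0 ≤ θ → θ ≤ Real.pi →
      volume.real {y : Space (m + 1) | ‖y‖ ≤ 1 ∧ Real.cos θ ≤ inner ℝ e y}
      = unitBallVolume m * capIntegral (m + 1) θ := by
    intro θ h0 hπ
    rw [← volume_real_unit_cap_first m h0 hπ]
    obtain ⟨f, hf⟩ := exists_linearIsometryEquiv_map_eq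
      (e := e) (e' := EuclideanSpace.single (0 : Fin (m + 1)) (1 : ℝ)) (by simp [he])
    have hm : MeasurableSet {y : Space (m + 1) | ‖y‖ ≤ 1 ∧ Real.cos θ ≤ y 0} := by
      rw [ofPred_and]
      exact ((isClosed_le (by fun_prop) (by fun_prop)).inter
        (isClosed_le (by fun_prop) (by fun_prop))).measurableSet
    rw [Measure.real, Measure.real, ← f.measurePreserving.measure_preimage hm.nullMeasurableSet]
    congr 2
    ext y
    have : inner ℝ e y = (f y) 0 := by
      rw [← f.inner_map_map e y, hf]
      simp [EuclideanSpace.inner_single_left]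
    simp [this]
  -- the cap of angular radius `π` is the whole ball, which fixes the normalisation
  have hball : unitBallVolume (m + 1) = unitBallVolume m * capIntegral (m + 1) Real.pi := by
    rw [← hunit Real.pi Real.pi_pos.le le_rfl, unitBallVolume, Measure.real, Measure.real,
      ← Measure.addHaar_unitClosedBall_eq_addHaar_unitBall]
    congr 2
    ext y
    simp only [Metric.mem_closedBall, dist_zero_right, mem_ofPred_eq, Real.cos_pi]
    refine ⟨fun h => ⟨h, ?_⟩, fun h => h.1⟩
    have := abs_real_inner_le_norm e y
    rw [he, one_mul] at this
    linarith [neg_abs_le (inner ℝ e y)]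
  have hscale : {y : Space (m + 1) | ‖y‖ ≤ R ∧ R * Real.cos θ ≤ inner ℝ e y}
      = R • {y : Space (m + 1) | ‖y‖ ≤ 1 ∧ Real.cos θ ≤ inner ℝ e y} := by
    ext y
    rw [mem_smul_set_iff_inv_smul_mem₀ hR.ne']
    simp only [mem_ofPred_eq, norm_smul, inner_smul_right, norm_inv, Real.norm_eq_abs,
      abs_of_pos hR]
    rw [inv_mul_le_iff₀ hR, le_inv_mul_iff₀ hR, mul_one]
  rw [hscale, measureReal_def, Measure.addHaar_smul, ENNReal.toReal_mul, ← measureReal_def,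
    hunit θ h0 hπ, finrank_euclideanSpace, Fintype.card_fin, abs_of_pos (pow_pos hR _),
    ENNReal.toReal_ofReal (pow_pos hR _).le, hball, capFraction]
  field_simp [(capIntegral_pi_pos (m + 1)).ne']

/-! ### Lenses and cones -/

lemma volume_hyperplane {n : ℕ} {e : Space n} (he : ‖e‖ = 1) (p : ℝ) :
    volume {y : Space n | inner ℝ e y = p} = 0 := by
  have hs : ((AffineSubspace.mk' (p • e) (LinearMap.ker (innerSL ℝ e).toLinearMap) :
      AffineSubspace ℝ (Space n)) : Set (Space n)) = {y : Space n | inner ℝ e y = p} := by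
    ext y
    simp only [SetLike.mem_coe, AffineSubspace.mem_mk', vsub_eq_sub, LinearMap.mem_ker,
      mem_ofPred_eq, ContinuousLinearMap.coe_coe, innerSL_apply_apply, inner_sub_right,
      inner_smul_right, real_inner_self_eq_norm_sq, he]
    constructor <;> intro h <;> linarith
  rw [← hs]
  refine Measure.addHaar_affineSubspace _ _ fun h => ?_
  have h1 : (p + 1) • e ∈ ((AffineSubspace.mk' (p • e) (LinearMap.ker (innerSL ℝ e).toLinearMap) :
      AffineSubspace ℝ (Space n)) : Set (Space n)) := by rw [h]; trivial
  rw [hs, mem_ofPred_eq, inner_smul_right, real_inner_self_eq_norm_sq, he] at h1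
  linarith

/-- The volume of a lens, the intersection of two balls at distance `R₁` of their centres: the
radical hyperplane cuts it into two caps, whose angular radii are the angles at the two centres of
the triangle with sides `R₁, R₂, R₃`. -/
lemma volume_real_lens {n : ℕ} (hn : 1 ≤ n) {R₁ R₂ R₃ θ₂ θ₃ : ℝ} (h₁ : 0 < R₁) (h₂ : 0 < R₂)
    (h₃ : 0 < R₃) (hθ₂ : θ₂ ∈ Icc 0 Real.pi) (hθ₃ : θ₃ ∈ Icc 0 Real.pi)
    (hproj : R₁ = R₂ * Real.cos θ₃ + R₃ * Real.cos θ₂)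
    (hcos : R₃ ^ 2 = R₁ ^ 2 + R₂ ^ 2 - 2 * R₁ * R₂ * Real.cos θ₃) {x : Space n} (hx : ‖x‖ = R₁) :
    volume.real {y : Space n | ‖y‖ ≤ R₂ ∧ ‖x - y‖ ≤ R₃}
      = unitBallVolume n * R₂ ^ n * capFraction n θ₃
        + unitBallVolume n * R₃ ^ n * capFraction n θ₂ := by
  set e : Space n := R₁⁻¹ • x with he_def
  have he : ‖e‖ = 1 := by
    rw [he_def, norm_smul, hx, norm_inv, Real.norm_eq_abs, abs_of_pos h₁, inv_mul_cancel₀ h₁.ne']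
  have hxe : x = R₁ • e := by rw [he_def, smul_smul, mul_inv_cancel₀ h₁.ne', one_smul]
  have hinner : ∀ y, inner ℝ e (x - y) = R₁ - inner ℝ e y := by
    intro y
    rw [inner_sub_right, hxe, inner_smul_right, real_inner_self_eq_norm_sq, he]
    ring
  have hdist : ∀ y, ‖x - y‖ ^ 2 = R₁ ^ 2 - 2 * R₁ * inner ℝ e y + ‖y‖ ^ 2 := by
    intro y
    rw [norm_sub_sq_real, hx]
    nth_rewrite 1 [hxe]
    rw [real_inner_smul_left]
    ring
  set A : Set (Space n) := {y | ‖y‖ ≤ R₂ ∧ R₂ * Real.cos θ₃ ≤ inner ℝ e y} with hA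
  set B' : Set (Space n) := {y | ‖y‖ ≤ R₃ ∧ R₃ * Real.cos θ₂ ≤ inner ℝ e y} with hB'
  set B : Set (Space n) := (fun y => x - y) ⁻¹' B' with hB
  have hB'm : MeasurableSet B' := by
    rw [hB', ofPred_and]
    exact ((isClosed_le (by fun_prop) (by fun_prop)).inter
      (isClosed_le (by fun_prop) (by fun_prop))).measurableSet
  have hBm : MeasurableSet B := hB'm.preimage (by fun_prop)
  have hsub : {y : Space n | ‖y‖ ≤ R₂ ∧ ‖x - y‖ ≤ R₃} = A ∪ B := by
    ext y
    simp only [hA, hB, hB', mem_union, mem_preimage, mem_ofPred_eq, hinner]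
    have hd := hdist y
    constructor
    · rintro ⟨hy1, hy2⟩
      rcases le_total (R₂ * Real.cos θ₃) (inner ℝ e y) with h | h
      · exact Or.inl ⟨hy1, h⟩
      · exact Or.inr ⟨hy2, by linarith⟩
    · rintro (⟨hy1, hy2⟩ | ⟨hy1, hy2⟩)
      · refine ⟨hy1, abs_le_of_sq_le_sq' ?_ h₃.le |>.2⟩
        nlinarith [norm_nonneg y, mul_le_mul_of_nonneg_left hy2 h₁.le]
      · refine ⟨abs_le_of_sq_le_sq' ?_ h₂.le |>.2, hy1⟩
        have : inner ℝ e y ≤ R₂ * Real.cos θ₃ := by linarith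
        nlinarith [norm_nonneg (x - y), mul_le_mul_of_nonneg_left this h₁.le]
  have hnull : AEDisjoint volume A B := by
    refine measure_mono_null (fun y hy => ?_) (volume_hyperplane he (R₂ * Real.cos θ₃))
    have h1 := hy.1.2
    have h2 := hy.2.2
    simp only [hinner] at h2
    exact le_antisymm (by linarith) h1
  have hfin : ∀ {S : Set (Space n)} {r : ℝ} {c : Space n}, S ⊆ Metric.closedBall c r →
      volume S ≠ ⊤ := fun h => ((measure_mono h).trans_lt measure_closedBall_lt_top).ne
  have hAf : volume A ≠ ⊤ := hfin (r := R₂) (c := 0) fun y hy => by simpa using hy.1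
  have hBf : volume B ≠ ⊤ := hfin (r := R₃) (c := x) fun y hy => by
    rw [Metric.mem_closedBall, dist_comm, dist_eq_norm]; exact hy.1
  rw [hsub, measureReal_def, measure_union₀ hBm.nullMeasurableSet hnull, ENNReal.toReal_add hAf hBf]
  congr 1
  · exact volume_real_cap hn he h₂ hθ₃.1 hθ₃.2
  · rw [hB, (Measure.measurePreserving_sub_left volume x).measure_preimage hB'm.nullMeasurableSet]
    exact volume_real_cap hn he h₃ hθ₂.1 hθ₂.2

lemma integral_ball_norm_pow {n : ℕ} (hn : 1 ≤ n) {R : ℝ} (hR : 0 < R) :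
    ∫ x in Metric.ball (0 : Space n) R, ‖x‖ ^ n = unitBallVolume n * R ^ (2 * n) / 2 := by
  have : Nonempty (Fin n) := ⟨⟨0, hn⟩⟩
  have h := integral_fun_norm_addHaar (volume : Measure (Space n))
    (fun r => (Iio R).indicator (fun r : ℝ => r ^ n) r)
  have h1 : ∀ x : Space n, (Iio R).indicator (fun r : ℝ => r ^ n) ‖x‖
      = (Metric.ball (0 : Space n) R).indicator (fun x => ‖x‖ ^ n) x := by
    intro x
    simp [indicator, Metric.mem_ball]
  simp only [h1] at h
  rw [← integral_indicator measurableSet_ball, h, finrank_euclideanSpace, Fintype.card_fin]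
  have h2 : ∫ y in Ioi (0 : ℝ), y ^ (n - 1) • (Iio R).indicator (fun r : ℝ => r ^ n) y
      = ∫ y in (0 : ℝ)..R, y ^ (2 * n - 1) := by
    rw [intervalIntegral.integral_of_le hR.le, integral_Ioc_eq_integral_Ioo,
      ← integral_indicator measurableSet_Ioo, ← integral_indicator measurableSet_Ioi]
    refine integral_congr_ae (Filter.Eventually.of_forall fun y => ?_)
    simp only [indicator, mem_Ioi, mem_Iio, mem_Ioo, smul_eq_mul]
    by_cases hy : 0 < y <;> by_cases hy' : y < R <;> simp [hy, hy', ← pow_add]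
    congr 1; omega
  rw [h2, integral_pow]
  have h3 : 2 * n - 1 + 1 = 2 * n := by omega
  have h4 : (((2 * n - 1 : ℕ) : ℝ) + 1) = 2 * n := by exact_mod_cast h3
  have hn0 : (n : ℝ) ≠ 0 := by exact_mod_cast (by omega : n ≠ 0)
  rw [h3, h4, zero_pow (by omega), sub_zero]
  simp only [nsmul_eq_mul, smul_eq_mul, unitBallVolume]
  field_simp

/-- The pairs `(x, y)` for which the largest of `‖x‖ / R₁`, `‖y‖ / R₂`, `‖x - y‖ / R₃` is the first
one, and is less than `1`. -/
def pairCone (n : ℕ) (R₁ R₂ R₃ : ℝ) : Set (Space n × Space n) :=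
  {p | ‖p.1‖ < R₁ ∧ ‖p.2‖ * R₁ ≤ R₂ * ‖p.1‖ ∧ ‖p.1 - p.2‖ * R₁ ≤ R₃ * ‖p.1‖}

lemma measurableSet_pairCone (n : ℕ) (R₁ R₂ R₃ : ℝ) : MeasurableSet (pairCone n R₁ R₂ R₃) := by
  unfold pairCone
  rw [ofPred_and, ofPred_and]
  exact (isOpen_lt (by fun_prop) (by fun_prop)).measurableSet.inter
    ((isClosed_le (by fun_prop) (by fun_prop)).measurableSet.inter
      (isClosed_le (by fun_prop) (by fun_prop)).measurableSet)

lemma volume_pairCone {n : ℕ} (hn : 1 ≤ n) {R₁ R₂ R₃ θ₂ θ₃ : ℝ} (h₁ : 0 < R₁) (h₂ : 0 < R₂)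
    (h₃ : 0 < R₃) (hθ₂ : θ₂ ∈ Icc 0 Real.pi) (hθ₃ : θ₃ ∈ Icc 0 Real.pi)
    (hproj : R₁ = R₂ * Real.cos θ₃ + R₃ * Real.cos θ₂)
    (hcos : R₃ ^ 2 = R₁ ^ 2 + R₂ ^ 2 - 2 * R₁ * R₂ * Real.cos θ₃) :
    volume (pairCone n R₁ R₂ R₃) = ENNReal.ofReal (unitBallVolume n * R₁ ^ n / 2 *
      (unitBallVolume n * R₂ ^ n * capFraction n θ₃
        + unitBallVolume n * R₃ ^ n * capFraction n θ₂)) := by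
  set L : ℝ := unitBallVolume n * R₂ ^ n * capFraction n θ₃
        + unitBallVolume n * R₃ ^ n * capFraction n θ₂ with hL
  have hq : ∀ θ ∈ Icc 0 Real.pi, 0 ≤ capFraction n θ := fun θ hθ => by
    rw [← capFraction_zero n]; exact capFraction_mono le_rfl hθ.1 hθ.2
  have hc := unitBallVolume_pos n
  have hL0 : 0 ≤ L := by
    have := hq _ hθ₂; have := hq _ hθ₃
    positivity
  have hslice : ∀ x : Space n, x ≠ 0 → volume (Prod.mk x ⁻¹' pairCone n R₁ R₂ R₃)
      = (Metric.ball (0 : Space n) R₁).indicator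
        (fun x => ENNReal.ofReal (‖x‖ ^ n * (L / R₁ ^ n))) x := by
    intro x hx
    by_cases hxR : ‖x‖ < R₁
    · rw [indicator_of_mem (by simpa using hxR)]
      have hx0 : 0 < ‖x‖ := norm_pos_iff.2 hx
      have hs : Prod.mk x ⁻¹' pairCone n R₁ R₂ R₃
          = {y : Space n | ‖y‖ ≤ R₂ * (‖x‖ / R₁) ∧ ‖x - y‖ ≤ R₃ * (‖x‖ / R₁)} := by
        ext y
        simp only [pairCone, mem_preimage, mem_ofPred_eq, hxR, true_and, ← mul_div_assoc,
          le_div_iff₀ h₁]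
      have hpos : 0 < ‖x‖ / R₁ := div_pos hx0 h₁
      have hlens := volume_real_lens hn (R₁ := ‖x‖) (R₂ := R₂ * (‖x‖ / R₁)) (R₃ := R₃ * (‖x‖ / R₁))
        hx0 (by positivity) (by positivity) hθ₂ hθ₃
        (by
          calc ‖x‖ = R₁ * (‖x‖ / R₁) := by field_simp
            _ = _ := by nth_rewrite 1 [hproj]; ring)
        (by
          have : ‖x‖ ^ 2 = R₁ ^ 2 * (‖x‖ / R₁) ^ 2 := by field_simp
          have h' : ‖x‖ = R₁ * (‖x‖ / R₁) := by field_simp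
          rw [mul_pow, hcos, this]
          nth_rewrite 5 [h']
          ring) (x := x) rfl
      rw [hs, ← ENNReal.ofReal_toReal (a := volume _) ?_, ← measureReal_def, hlens]
      · congr 1
        rw [hL]
        simp only [mul_pow, div_pow]
        field_simp
      · refine ((measure_mono (t := Metric.closedBall 0 (R₂ * (‖x‖ / R₁))) ?_).trans_lt
          measure_closedBall_lt_top).ne
        intro y hy
        simpa using hy.1
    · rw [indicator_of_notMem (by simpa using hxR)]
      have : Prod.mk x ⁻¹' pairCone n R₁ R₂ R₃ = ∅ := by
        ext y
        simp [pairCone, hxR]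
      rw [this, measure_empty]
  have : Nonempty (Fin n) := ⟨⟨0, hn⟩⟩
  have hae : ∀ᵐ x : Space n, x ≠ 0 := by
    rw [ae_iff]; simp
  rw [Measure.volume_eq_prod, Measure.prod_apply (measurableSet_pairCone n R₁ R₂ R₃),
    lintegral_congr_ae (hae.mono hslice), lintegral_indicator measurableSet_ball,
    ← ofReal_integral_eq_lintegral_ofReal, integral_mul_const, integral_ball_norm_pow hn h₁]
  · congr 1
    rw [pow_mul']
    field_simp
  · refine Integrable.mono_measure ?_ (Measure.restrict_mono Metric.ball_subset_closedBall le_rfl)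
    exact (Continuous.continuousOn (by fun_prop)).integrableOn_compact (isCompact_closedBall _ _)
  · exact Filter.Eventually.of_forall fun x => by positivity

/-! ### Triples of vectors with sum zero in three balls -/

/-- The pairs of vectors `x, y` with `x, y, x - y` in the balls of radii `R₁, R₂, R₃`. -/
def tripleSet (n : ℕ) (R₁ R₂ R₃ : ℝ) : Set (Space n × Space n) :=
  {p | ‖p.1‖ < R₁ ∧ ‖p.2‖ < R₂ ∧ ‖p.1 - p.2‖ < R₃}

lemma measurableSet_tripleSet (n : ℕ) (R₁ R₂ R₃ : ℝ) : MeasurableSet (tripleSet n R₁ R₂ R₃) := by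
  unfold tripleSet
  rw [ofPred_and, ofPred_and]
  exact ((isOpen_lt (by fun_prop) (by fun_prop)).inter
    ((isOpen_lt (by fun_prop) (by fun_prop)).inter
      (isOpen_lt (by fun_prop) (by fun_prop)))).measurableSet

lemma measurePreserving_sub_neg (n : ℕ) :
    MeasurePreserving (fun p : Space n × Space n => (p.1 - p.2, -p.2)) volume volume :=
  ((MeasurePreserving.id (volume : Measure (Space n))).prod
    (Measure.measurePreserving_neg (volume : Measure (Space n)))).comp
    (measurePreserving_sub_prod volume volume)

lemma volume_norm_mul_eq_norm_mul {n : ℕ} (hn : 1 ≤ n) {R₁ R₂ : ℝ} (h₁ : 0 < R₁) :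
    volume {p : Space n × Space n | ‖p.2‖ * R₁ = R₂ * ‖p.1‖} = 0 := by
  have : Nonempty (Fin n) := ⟨⟨0, hn⟩⟩
  have hm : MeasurableSet {p : Space n × Space n | ‖p.2‖ * R₁ = R₂ * ‖p.1‖} :=
    (isClosed_eq (by fun_prop) (by fun_prop)).measurableSet
  rw [Measure.volume_eq_prod, Measure.measure_prod_null hm]
  refine Filter.Eventually.of_forall fun x => ?_
  have : Prod.mk x ⁻¹' {p : Space n × Space n | ‖p.2‖ * R₁ = R₂ * ‖p.1‖}
      = Metric.sphere (0 : Space n) (R₂ * ‖x‖ / R₁) := by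
    ext y
    simp [eq_div_iff h₁.ne']
  simp only [this]
  exact Measure.addHaar_sphere _ _ _

lemma tripleSet_eq_union {n : ℕ} {R₁ R₂ R₃ : ℝ} (h₁ : 0 < R₁) (h₂ : 0 < R₂) (h₃ : 0 < R₃) :
    tripleSet n R₁ R₂ R₃ = pairCone n R₁ R₂ R₃ ∪ (Prod.swap ⁻¹' pairCone n R₂ R₁ R₃ ∪
      (fun p : Space n × Space n => (p.1 - p.2, -p.2)) ⁻¹' pairCone n R₃ R₂ R₁) := by
  ext ⟨x, y⟩
  simp only [tripleSet, pairCone, mem_union, mem_preimage, mem_ofPred_eq, Prod.fst_swap,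
    Prod.snd_swap, norm_neg, sub_neg_eq_add, sub_add_cancel, norm_sub_rev y x]
  -- `aᵢ` are the three norms in units of the corresponding radii
  obtain ⟨a₁, ha₁⟩ : ∃ a, ‖x‖ = R₁ * a := ⟨‖x‖ / R₁, by field_simp⟩
  obtain ⟨a₂, ha₂⟩ : ∃ a, ‖y‖ = R₂ * a := ⟨‖y‖ / R₂, by field_simp⟩
  obtain ⟨a₃, ha₃⟩ : ∃ a, ‖x - y‖ = R₃ * a := ⟨‖x - y‖ / R₃, by field_simp⟩
  have key : ∀ {r s a b : ℝ}, 0 < r → 0 < s → (r * a * s ≤ r * (s * b) ↔ a ≤ b) := by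
    intro r s a b hr hs
    rw [mul_assoc, mul_le_mul_iff_right₀ hr, mul_comm a s, mul_le_mul_iff_right₀ hs]
  have key' : ∀ {r a : ℝ}, 0 < r → (r * a < r ↔ a < 1) := by
    intro r a hr
    rw [mul_lt_iff_lt_one_right hr]
  rw [ha₁, ha₂, ha₃, key h₂ h₁, key h₃ h₁, key h₁ h₂, key h₃ h₂, key h₂ h₃, key h₁ h₃, key' h₁,
    key' h₂, key' h₃]
  constructor
  · rintro ⟨h1, h2, h3⟩
    rcases le_total a₁ a₂ with h | h
    · rcases le_total a₂ a₃ with h' | h'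
      · exact Or.inr (Or.inr ⟨h3, h', h.trans h'⟩)
      · exact Or.inr (Or.inl ⟨h2, h, h'⟩)
    · rcases le_total a₁ a₃ with h' | h'
      · exact Or.inr (Or.inr ⟨h3, h.trans h', h'⟩)
      · exact Or.inl ⟨h1, h, h'⟩
  · rintro (⟨h1, h2, h3⟩ | ⟨h1, h2, h3⟩ | ⟨h1, h2, h3⟩) <;> refine ⟨?_, ?_, ?_⟩ <;> linarith

lemma sin_triangle_proj {α β γ : ℝ} (h : α + β + γ = Real.pi) :
    Real.sin α = Real.sin β * Real.cos γ + Real.sin γ * Real.cos β := by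
  have : α = Real.pi - (β + γ) := by linarith
  rw [this, Real.sin_pi_sub, Real.sin_add]
  ring

lemma sin_triangle_cos {α β γ : ℝ} (h : α + β + γ = Real.pi) :
    Real.sin γ ^ 2 = Real.sin α ^ 2 + Real.sin β ^ 2
      - 2 * Real.sin α * Real.sin β * Real.cos γ := by
  have : γ = Real.pi - (α + β) := by linarith
  rw [this, Real.sin_pi_sub, Real.cos_pi_sub, Real.sin_add, Real.cos_add]
  have h1 := Real.sin_sq_add_cos_sq α
  have h2 := Real.sin_sq_add_cos_sq β
  linear_combination Real.sin β ^ 2 * h1 + Real.sin α ^ 2 * h2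

/-- If `R₁, R₂, R₃` are the sides of a triangle with opposite angles `θ₁, θ₂, θ₃`, then the volume
of `tripleSet` is a combination of cap fractions. The set is a union of three cones, according to
which of `‖x‖ / R₁`, `‖y‖ / R₂`, `‖x - y‖ / R₃` is the largest, and the base of each cone is a lens
made of two caps. -/
lemma volume_real_tripleSet {n : ℕ} (hn : 1 ≤ n) {R₁ R₂ R₃ θ₁ θ₂ θ₃ κ : ℝ} (hκ : 0 < κ)
    (hθ₁ : θ₁ ∈ Ioo 0 Real.pi) (hθ₂ : θ₂ ∈ Ioo 0 Real.pi) (hθ₃ : θ₃ ∈ Ioo 0 Real.pi)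
    (hsum : θ₁ + θ₂ + θ₃ = Real.pi)
    (hR₁ : R₁ = κ * Real.sin θ₁) (hR₂ : R₂ = κ * Real.sin θ₂) (hR₃ : R₃ = κ * Real.sin θ₃) :
    volume.real (tripleSet n R₁ R₂ R₃) = unitBallVolume n ^ 2 *
      (R₂ ^ n * R₃ ^ n * capFraction n θ₁ + R₁ ^ n * R₃ ^ n * capFraction n θ₂
        + R₁ ^ n * R₂ ^ n * capFraction n θ₃) := by
  have h₁ : 0 < R₁ := hR₁ ▸ mul_pos hκ (Real.sin_pos_of_mem_Ioo hθ₁)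
  have h₂ : 0 < R₂ := hR₂ ▸ mul_pos hκ (Real.sin_pos_of_mem_Ioo hθ₂)
  have h₃ : 0 < R₃ := hR₃ ▸ mul_pos hκ (Real.sin_pos_of_mem_Ioo hθ₃)
  have hq : ∀ θ ∈ Ioo 0 Real.pi, 0 ≤ capFraction n θ := fun θ hθ => by
    rw [← capFraction_zero n]; exact capFraction_mono le_rfl hθ.1.le hθ.2.le
  have hc := unitBallVolume_pos n
  have hproj : ∀ {α β γ : ℝ}, α + β + γ = Real.pi → κ * Real.sin α
      = κ * Real.sin β * Real.cos γ + κ * Real.sin γ * Real.cos β := by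
    intro α β γ h
    rw [sin_triangle_proj h]; ring
  have hcos : ∀ {α β γ : ℝ}, α + β + γ = Real.pi → (κ * Real.sin γ) ^ 2
      = (κ * Real.sin α) ^ 2 + (κ * Real.sin β) ^ 2
        - 2 * (κ * Real.sin α) * (κ * Real.sin β) * Real.cos γ := by
    intro α β γ h
    rw [mul_pow, sin_triangle_cos h]; ring
  have hC₁ := volume_pairCone hn h₁ h₂ h₃ (Ioo_subset_Icc_self hθ₂) (Ioo_subset_Icc_self hθ₃)
    (by rw [hR₁, hR₂, hR₃]; exact hproj hsum) (by rw [hR₁, hR₂, hR₃]; exact hcos hsum)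
  have hC₂ := volume_pairCone hn h₂ h₁ h₃ (Ioo_subset_Icc_self hθ₁) (Ioo_subset_Icc_self hθ₃)
    (by rw [hR₁, hR₂, hR₃]; exact hproj (by linarith))
    (by rw [hR₁, hR₂, hR₃]; exact hcos (by linarith))
  have hC₃ := volume_pairCone hn h₃ h₂ h₁ (Ioo_subset_Icc_self hθ₂) (Ioo_subset_Icc_self hθ₁)
    (by rw [hR₁, hR₂, hR₃]; exact hproj (by linarith))
    (by rw [hR₁, hR₂, hR₃]; exact hcos (by linarith))
  have hswap : MeasurePreserving (Prod.swap : Space n × Space n → Space n × Space n) volume volume :=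
    Measure.measurePreserving_swap
  have hm₂ : MeasurableSet (Prod.swap ⁻¹' pairCone n R₂ R₁ R₃) :=
    hswap.measurable (measurableSet_pairCone n R₂ R₁ R₃)
  have hm₃ : MeasurableSet ((fun p : Space n × Space n => (p.1 - p.2, -p.2)) ⁻¹'
      pairCone n R₃ R₂ R₁) :=
    (measurePreserving_sub_neg n).measurable (measurableSet_pairCone n R₃ R₂ R₁)
  have hd₁ : AEDisjoint volume (pairCone n R₁ R₂ R₃) (Prod.swap ⁻¹' pairCone n R₂ R₁ R₃ ∪
      (fun p : Space n × Space n => (p.1 - p.2, -p.2)) ⁻¹' pairCone n R₃ R₂ R₁) := by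
    refine AEDisjoint.union_right ?_ ?_
    · refine measure_mono_null ?_ (volume_norm_mul_eq_norm_mul hn (R₂ := R₂) h₁)
      rintro ⟨x, y⟩ ⟨hp, hp'⟩
      simp only [pairCone, mem_preimage, mem_ofPred_eq, Prod.fst_swap, Prod.snd_swap] at hp hp' ⊢
      nlinarith
    · have h0 := volume_norm_mul_eq_norm_mul hn (R₂ := R₃) h₁
      have hmp : MeasurePreserving (fun p : Space n × Space n => (p.1, p.2 - p.1)) volume volume :=
        measurePreserving_prod_sub volume volume
      rw [← hmp.measure_preimage
        (isClosed_eq (by fun_prop) (by fun_prop)).nullMeasurableSet] at h0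
      refine measure_mono_null ?_ h0
      rintro ⟨x, y⟩ ⟨hp, hp'⟩
      simp only [pairCone, mem_preimage, mem_ofPred_eq, norm_neg, sub_neg_eq_add,
        sub_add_cancel, norm_sub_rev y x] at hp hp' ⊢
      nlinarith
  have hd₂ : AEDisjoint volume (Prod.swap ⁻¹' pairCone n R₂ R₁ R₃)
      ((fun p : Space n × Space n => (p.1 - p.2, -p.2)) ⁻¹' pairCone n R₃ R₂ R₁) := by
    have h0 := volume_norm_mul_eq_norm_mul hn (R₂ := R₂) h₃
    rw [← (measurePreserving_sub_neg n).measure_preimage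
      (isClosed_eq (by fun_prop) (by fun_prop)).nullMeasurableSet] at h0
    refine measure_mono_null ?_ h0
    rintro ⟨x, y⟩ ⟨hp, hp'⟩
    simp only [pairCone, mem_preimage, mem_ofPred_eq, norm_neg, sub_neg_eq_add,
      sub_add_cancel, norm_sub_rev y x, Prod.fst_swap, Prod.snd_swap] at hp hp' ⊢
    nlinarith
  have hq₁ := hq _ hθ₁
  have hq₂ := hq _ hθ₂
  have hq₃ := hq _ hθ₃
  rw [measureReal_def, tripleSet_eq_union h₁ h₂ h₃, measure_union₀ (hm₂.union hm₃).nullMeasurableSet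
    hd₁, measure_union₀ hm₃.nullMeasurableSet hd₂,
    hswap.measure_preimage (measurableSet_pairCone n R₂ R₁ R₃).nullMeasurableSet,
    (measurePreserving_sub_neg n).measure_preimage
      (measurableSet_pairCone n R₃ R₂ R₁).nullMeasurableSet, hC₁, hC₂, hC₃,
    ← ENNReal.ofReal_add (by positivity) (by positivity),
    ← ENNReal.ofReal_add (by positivity) (by positivity), ENNReal.toReal_ofReal (by positivity)]
  ring

/-! ### Concavity of the overlap of two balls -/

/-- The radius of the ball of `ℝⁿ` on which a uniform probability density of height `a` lives. -/
noncomputable def massRadius (n : ℕ) (a : ℝ) : ℝ := (unitBallVolume n * a) ^ (-1 / (n : ℝ))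

lemma massRadius_pos {n : ℕ} {a : ℝ} (ha : 0 < a) : 0 < massRadius n a :=
  Real.rpow_pos_of_pos (mul_pos (unitBallVolume_pos n) ha) _

lemma unitBallVolume_mul_massRadius_pow {n : ℕ} (hn : 1 ≤ n) {a : ℝ} (ha : 0 < a) :
    unitBallVolume n * massRadius n a ^ n = a⁻¹ := by
  have hc := unitBallVolume_pos n
  have hn0 : (n : ℝ) ≠ 0 := by exact_mod_cast (by omega : n ≠ 0)
  rw [massRadius, ← Real.rpow_natCast, ← Real.rpow_mul (mul_pos hc ha).le,
    div_mul_cancel₀ _ hn0, Real.rpow_neg_one]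
  field_simp

lemma massRadius_inv {n : ℕ} (hn : 1 ≤ n) {R : ℝ} (hR : 0 < R) :
    massRadius n (unitBallVolume n * R ^ n)⁻¹ = R := by
  have hc := unitBallVolume_pos n
  have h := unitBallVolume_mul_massRadius_pow hn (a := (unitBallVolume n * R ^ n)⁻¹)
    (by positivity)
  rw [inv_inv] at h
  exact (pow_left_inj₀ (massRadius_pos (by positivity)).le hR.le (by omega)).1
    (mul_left_cancel₀ hc.ne' h)

lemma volume_real_ball_massRadius {n : ℕ} (hn : 1 ≤ n) {a : ℝ} (ha : 0 < a) :
    volume.real (Metric.ball (0 : Space n) (massRadius n a)) = a⁻¹ := by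
  rw [← unitBallVolume_mul_massRadius_pow hn ha, measureReal_def,
    Measure.addHaar_ball_of_pos _ _ (massRadius_pos ha), ENNReal.toReal_mul,
    ENNReal.toReal_ofReal (pow_pos (massRadius_pos ha) _).le, finrank_euclideanSpace,
    Fintype.card_fin, mul_comm]
  rfl

/-- For independent uniform random vectors `X, Y` in the balls of volumes `1 / a`, `1 / b`, this is
`c` times the probability that `X - Y` lies in the ball of volume `1 / c`. -/
noncomputable def ballOverlap (n : ℕ) (a b c : ℝ) : ℝ :=
  a * b * c * volume.real (tripleSet n (massRadius n a) (massRadius n b) (massRadius n c))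

lemma ballOverlap_eq_of_volume_eq {n : ℕ} {a b c v : ℝ} (h : volume.real
    (tripleSet n (massRadius n a) (massRadius n b) (massRadius n c)) = v) :
    ballOverlap n a b c = a * b * c * v := by rw [ballOverlap, h]

lemma volume_real_ball_prod {n : ℕ} (hn : 1 ≤ n) {a b : ℝ} (ha : 0 < a) (hb : 0 < b) :
    volume.real (Metric.ball (0 : Space n) (massRadius n a) ×ˢ
      Metric.ball (0 : Space n) (massRadius n b)) = a⁻¹ * b⁻¹ := by
  rw [measureReal_def, Measure.volume_eq_prod, Measure.prod_prod, ENNReal.toReal_mul,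
    ← measureReal_def, ← measureReal_def, volume_real_ball_massRadius hn ha,
    volume_real_ball_massRadius hn hb]

lemma measure_ball_prod_ne_top {n : ℕ} (R S : ℝ) :
    volume (Metric.ball (0 : Space n) R ×ˢ Metric.ball (0 : Space n) S) ≠ ⊤ := by
  rw [Measure.volume_eq_prod, Measure.prod_prod]
  exact ENNReal.mul_ne_top measure_ball_lt_top.ne measure_ball_lt_top.ne

lemma ballOverlap_nonneg {n : ℕ} {a b c : ℝ} (ha : 0 < a) (hb : 0 < b) (hc : 0 < c) :
    0 ≤ ballOverlap n a b c := by
  unfold ballOverlap; positivity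

lemma volume_real_of_fst_free {n : ℕ} (hn : 1 ≤ n) {b c : ℝ} (hb : 0 < b) (hc : 0 < c) :
    volume.real ((fun p : Space n × Space n => (p.1 - p.2, -p.2)) ⁻¹'
      (Metric.ball (0 : Space n) (massRadius n c) ×ˢ Metric.ball (0 : Space n) (massRadius n b)))
      = c⁻¹ * b⁻¹ := by
  rw [measureReal_def, (measurePreserving_sub_neg n).measure_preimage
    (measurableSet_ball.prod measurableSet_ball).nullMeasurableSet, ← measureReal_def,
    volume_real_ball_prod hn hc hb]

lemma tripleSet_subset_fst_free {n : ℕ} {R₁ R₂ R₃ : ℝ} : tripleSet n R₁ R₂ R₃ ⊆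
    (fun p : Space n × Space n => (p.1 - p.2, -p.2)) ⁻¹'
      (Metric.ball (0 : Space n) R₃ ×ˢ Metric.ball (0 : Space n) R₂) := by
  rintro ⟨x, y⟩ ⟨_, h2, h3⟩
  simp only [mem_preimage, mem_prod, mem_ball_zero_iff, norm_neg]
  exact ⟨h3, h2⟩

lemma ballOverlap_le_fst {n : ℕ} (hn : 1 ≤ n) {a b c : ℝ} (ha : 0 < a) (hb : 0 < b) (hc : 0 < c) :
    ballOverlap n a b c ≤ a := by
  have h : volume.real (tripleSet n (massRadius n a) (massRadius n b) (massRadius n c))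
      ≤ c⁻¹ * b⁻¹ := by
    rw [← volume_real_of_fst_free hn hb hc]
    refine measureReal_mono tripleSet_subset_fst_free ?_
    rw [(measurePreserving_sub_neg n).measure_preimage
      (measurableSet_ball.prod measurableSet_ball).nullMeasurableSet]
    exact measure_ball_prod_ne_top _ _
  calc ballOverlap n a b c ≤ a * b * c * (c⁻¹ * b⁻¹) :=
        mul_le_mul_of_nonneg_left h (by positivity)
    _ = a := by field_simp

/-- If the first radius is at least the sum of the others, the condition on the first vector is
automatic. -/
lemma ballOverlap_eq_fst {n : ℕ} (hn : 1 ≤ n) {a b c : ℝ} (hb : 0 < b) (hc : 0 < c)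
    (h : massRadius n b + massRadius n c ≤ massRadius n a) : ballOverlap n a b c = a := by
  rw [ballOverlap_eq_of_volume_eq (v := c⁻¹ * b⁻¹)]
  · field_simp
  · rw [← volume_real_of_fst_free hn hb hc]
    congr 1
    refine tripleSet_subset_fst_free.antisymm ?_
    rintro ⟨x, y⟩ hxy
    simp only [mem_preimage, mem_prod, mem_ball_zero_iff, norm_neg] at hxy
    refine ⟨?_, hxy.2, hxy.1⟩
    have := norm_add_le (x - y) y
    rw [sub_add_cancel] at this
    show ‖x‖ < _
    linarith [hxy.1, hxy.2]

lemma ballOverlap_swap (n : ℕ) (a b c : ℝ) : ballOverlap n a b c = ballOverlap n b a c := by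
  have hswap : MeasurePreserving (Prod.swap : Space n × Space n → Space n × Space n) volume volume :=
    Measure.measurePreserving_swap
  have : volume.real (tripleSet n (massRadius n a) (massRadius n b) (massRadius n c))
      = volume.real (tripleSet n (massRadius n b) (massRadius n a) (massRadius n c)) := by
    rw [measureReal_def, measureReal_def, ← hswap.measure_preimage
      (measurableSet_tripleSet n _ _ _).nullMeasurableSet]
    congr 2
    ext ⟨x, y⟩
    simp only [tripleSet, mem_preimage, mem_ofPred_eq, Prod.fst_swap, Prod.snd_swap,
      norm_sub_rev y x]
    tauto
  rw [ballOverlap, ballOverlap, this]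
  ring

lemma tripleSet_subset_ball_prod {n : ℕ} {R₁ R₂ R₃ : ℝ} : tripleSet n R₁ R₂ R₃ ⊆
      (Metric.ball (0 : Space n) R₁ ×ˢ Metric.ball (0 : Space n) R₂) := by
  rintro ⟨x, y⟩ ⟨h1, h2, _⟩
  simpa only [mem_prod, mem_ball_zero_iff] using ⟨h1, h2⟩

lemma ballOverlap_le_thd {n : ℕ} (hn : 1 ≤ n) {a b c : ℝ} (ha : 0 < a) (hb : 0 < b) (hc : 0 < c) :
    ballOverlap n a b c ≤ c := by
  have h : volume.real (tripleSet n (massRadius n a) (massRadius n b) (massRadius n c))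
      ≤ a⁻¹ * b⁻¹ := by
    rw [← volume_real_ball_prod hn ha hb]
    exact measureReal_mono tripleSet_subset_ball_prod (measure_ball_prod_ne_top _ _)
  calc ballOverlap n a b c ≤ a * b * c * (a⁻¹ * b⁻¹) :=
        mul_le_mul_of_nonneg_left h (by positivity)
    _ = c := by field_simp

lemma ballOverlap_eq_thd {n : ℕ} (hn : 1 ≤ n) {a b c : ℝ} (ha : 0 < a) (hb : 0 < b)
    (h : massRadius n a + massRadius n b ≤ massRadius n c) : ballOverlap n a b c = c := by
  rw [ballOverlap_eq_of_volume_eq (v := a⁻¹ * b⁻¹)]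
  · field_simp
  · rw [← volume_real_ball_prod hn ha hb]
    congr 1
    refine tripleSet_subset_ball_prod.antisymm ?_
    rintro ⟨x, y⟩ hxy
    simp only [mem_prod, mem_ball_zero_iff] at hxy
    refine ⟨hxy.1, hxy.2, ?_⟩
    have := norm_sub_le x y
    show ‖x - y‖ < _
    linarith [hxy.1, hxy.2]

/-- The combination of cap fractions of three angles whose minimum over `θ₁ + θ₂ + θ₃ = π` is
`ballOverlap n a b c`. -/
noncomputable def capSum (n : ℕ) (a b c : ℝ) (θ₁ θ₂ θ₃ : ℝ) : ℝ :=
  a * capFraction n θ₁ + b * capFraction n θ₂ + c * capFraction n θ₃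

/-- Equality at the angles of a triangle: the hypothesis is the law of sines. -/
lemma ballOverlap_eq_capSum {n : ℕ} (hn : 1 ≤ n) {a b c θ₁ θ₂ θ₃ κ : ℝ} (ha : 0 < a) (hb : 0 < b)
    (hc : 0 < c) (hκ : 0 < κ)
    (hθ₁ : θ₁ ∈ Ioo 0 Real.pi) (hθ₂ : θ₂ ∈ Ioo 0 Real.pi) (hθ₃ : θ₃ ∈ Ioo 0 Real.pi)
    (hsum : θ₁ + θ₂ + θ₃ = Real.pi)
    (h₁ : massRadius n a = κ * Real.sin θ₁) (h₂ : massRadius n b = κ * Real.sin θ₂)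
    (h₃ : massRadius n c = κ * Real.sin θ₃) :
    ballOverlap n a b c = capSum n a b c θ₁ θ₂ θ₃ := by
  have hV : unitBallVolume n ^ 2 *
      (massRadius n b ^ n * massRadius n c ^ n * capFraction n θ₁
        + massRadius n a ^ n * massRadius n c ^ n * capFraction n θ₂
        + massRadius n a ^ n * massRadius n b ^ n * capFraction n θ₃)
      = b⁻¹ * c⁻¹ * capFraction n θ₁ + a⁻¹ * c⁻¹ * capFraction n θ₂
        + a⁻¹ * b⁻¹ * capFraction n θ₃ := by
    rw [← unitBallVolume_mul_massRadius_pow hn ha, ← unitBallVolume_mul_massRadius_pow hn hb,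
      ← unitBallVolume_mul_massRadius_pow hn hc]
    ring
  rw [ballOverlap, volume_real_tripleSet hn hκ hθ₁ hθ₂ hθ₃ hsum h₁ h₂ h₃, hV, capSum]
  field_simp

/-- The law of sines in the form in which it arises as a critical point equation for `capSum`. -/
lemma massRadius_eq_of_mul_sin_pow {n : ℕ} (hn : 1 ≤ n) {a b α β κ : ℝ} (ha : 0 < a) (hb : 0 < b)
    (hα : α ∈ Ioo 0 Real.pi) (hβ : β ∈ Ioo 0 Real.pi) (hκ : 0 < κ)
    (h : a * Real.sin α ^ n = b * Real.sin β ^ n)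
    (hb' : massRadius n b = κ * Real.sin β) : massRadius n a = κ * Real.sin α := by
  have hsα := Real.sin_pos_of_mem_Ioo hα
  have hsβ := Real.sin_pos_of_mem_Ioo hβ
  have h1 := unitBallVolume_mul_massRadius_pow hn ha
  have h2 := unitBallVolume_mul_massRadius_pow hn hb
  have hc := unitBallVolume_pos n
  rw [hb', mul_pow] at h2
  refine (pow_left_inj₀ (massRadius_pos ha).le (by positivity) (by omega : n ≠ 0)).1 ?_
  refine mul_left_cancel₀ hc.ne' ?_
  rw [h1, mul_pow]
  have h3 : unitBallVolume n * κ ^ n * Real.sin β ^ n * b = 1 := by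
    rw [mul_assoc (unitBallVolume n), h2, inv_mul_cancel₀ hb.ne']
  refine inv_eq_iff_eq_inv.2 (eq_inv_of_mul_eq_one_left ?_)
  linear_combination unitBallVolume n * κ ^ n * h + h3

lemma mul_sin_pow_eq_of_massRadius {n : ℕ} (hn : 1 ≤ n) {a α κ : ℝ} (ha : 0 < a)
    (h : massRadius n a = κ * Real.sin α) :
    a * Real.sin α ^ n * (unitBallVolume n * κ ^ n) = 1 := by
  have h1 := unitBallVolume_mul_massRadius_pow hn ha
  rw [h, mul_pow] at h1
  field_simp at h1 ⊢
  linarith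

/-- An interior minimiser of `capSum` satisfies the law of sines. -/
lemma mul_sin_pow_eq_of_isMinOn {n : ℕ} {a b c θ₁ θ₂ θ₃ : ℝ}
    (h₁ : 0 < θ₁) (h₂ : 0 < θ₂) (h₃ : 0 < θ₃) (hsum : θ₁ + θ₂ + θ₃ = Real.pi)
    (hmin : ∀ φ₁ φ₂ φ₃, 0 ≤ φ₁ → 0 ≤ φ₂ → 0 ≤ φ₃ → φ₁ + φ₂ + φ₃ = Real.pi →
      capSum n a b c θ₁ θ₂ θ₃ ≤ capSum n a b c φ₁ φ₂ φ₃) :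
    a * Real.sin θ₁ ^ n = c * Real.sin θ₃ ^ n ∧ b * Real.sin θ₂ ^ n = c * Real.sin θ₃ ^ n := by
  have hI := capIntegral_pi_pos n
  have key : ∀ {a c α γ : ℝ}, (∀ᶠ t in nhds (0 : ℝ), a * capFraction n α + c * capFraction n γ
      ≤ a * capFraction n (α + t) + c * capFraction n (γ - t)) →
      a * Real.sin α ^ n = c * Real.sin γ ^ n := by
    intro a c α γ h
    have hd1 : HasDerivAt (fun t : ℝ => capFraction n (α + t))
        (Real.sin α ^ n / capIntegral n Real.pi) 0 := by
      have h0 : HasDerivAt (capFraction n) (Real.sin α ^ n / capIntegral n Real.pi) (α + 0) := by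
        simpa using hasDerivAt_capFraction n α
      exact h0.comp_const_add α 0
    have hd2 : HasDerivAt (fun t : ℝ => capFraction n (γ - t))
        (-(Real.sin γ ^ n / capIntegral n Real.pi)) 0 := by
      have h0 : HasDerivAt (capFraction n) (Real.sin γ ^ n / capIntegral n Real.pi) (γ - 0) := by
        simpa using hasDerivAt_capFraction n γ
      exact h0.comp_const_sub γ 0
    have hd := (hd1.const_mul a).add (hd2.const_mul c)
    have hlm : IsLocalMin ((fun t : ℝ => a * capFraction n (α + t)) +
        fun t => c * capFraction n (γ - t)) 0 := by
      filter_upwards [h] with t ht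
      simpa using ht
    have h0 := hlm.hasDerivAt_eq_zero hd
    field_simp at h0
    linarith
  have hsmall : ∀ {r : ℝ}, 0 < r → ∀ᶠ t in nhds (0 : ℝ), -r < t ∧ t < r := fun hr =>
    Ioo_mem_nhds (by linarith) hr
  constructor
  · refine key ?_
    filter_upwards [hsmall h₁, hsmall h₃] with t ht1 ht3
    have := hmin (θ₁ + t) θ₂ (θ₃ - t) (by linarith) h₂.le (by linarith) (by linarith)
    unfold capSum at this
    linarith
  · refine key ?_
    filter_upwards [hsmall h₂, hsmall h₃] with t ht1 ht3
    have := hmin θ₁ (θ₂ + t) (θ₃ - t) h₁.le (by linarith) (by linarith) (by linarith)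
    unfold capSum at this
    linarith

lemma exists_capSum_min (n : ℕ) (a b c : ℝ) : ∃ θ₁ θ₂ θ₃ : ℝ, 0 ≤ θ₁ ∧ 0 ≤ θ₂ ∧ 0 ≤ θ₃ ∧
    θ₁ + θ₂ + θ₃ = Real.pi ∧ ∀ φ₁ φ₂ φ₃, 0 ≤ φ₁ → 0 ≤ φ₂ → 0 ≤ φ₃ → φ₁ + φ₂ + φ₃ = Real.pi →
      capSum n a b c θ₁ θ₂ θ₃ ≤ capSum n a b c φ₁ φ₂ φ₃ := by
  set K : Set (ℝ × ℝ) := {p | 0 ≤ p.1 ∧ 0 ≤ p.2 ∧ p.1 + p.2 ≤ Real.pi} with hK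
  have hKc : IsCompact K := by
    refine (isCompact_Icc.prod isCompact_Icc : IsCompact (Icc 0 Real.pi ×ˢ Icc 0 Real.pi)
      ).of_isClosed_subset ?_ ?_
    · rw [hK, ofPred_and, ofPred_and]
      exact (isClosed_le (by fun_prop) (by fun_prop)).inter
        ((isClosed_le (by fun_prop) (by fun_prop)).inter
          (isClosed_le (by fun_prop) (by fun_prop)))
    · rintro ⟨x, y⟩ ⟨h1, h2, h3⟩
      simp only at h1 h2 h3
      exact ⟨⟨h1, by linarith⟩, ⟨h2, by linarith⟩⟩
  have hcont : Continuous fun p : ℝ × ℝ => capSum n a b c p.1 p.2 (Real.pi - p.1 - p.2) := by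
    have := continuous_capFraction n
    unfold capSum
    fun_prop
  obtain ⟨p, hp, hmin⟩ := hKc.exists_isMinOn ⟨(0, 0), by simp [hK, Real.pi_pos.le]⟩
    hcont.continuousOn
  refine ⟨p.1, p.2, Real.pi - p.1 - p.2, hp.1, hp.2.1, by linarith [hp.2.2], by ring, ?_⟩
  intro φ₁ φ₂ φ₃ h1 h2 h3 hs
  have hm := hmin (show (φ₁, φ₂) ∈ K from ⟨h1, h2, show φ₁ + φ₂ ≤ Real.pi by linarith⟩)
  have : φ₃ = Real.pi - φ₁ - φ₂ := by linarith
  rw [this]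
  exact hm

lemma le_mul_capFraction_add {n : ℕ} {a b v α β : ℝ} (ha : v ≤ a) (hb : v ≤ b) (hα : 0 ≤ α)
    (hβ : 0 ≤ β) (hsum : α + β = Real.pi) : v ≤ a * capFraction n α + b * capFraction n β := by
  have h0 : 0 ≤ capFraction n α := by
    rw [← capFraction_zero n]; exact capFraction_mono le_rfl hα (by linarith)
  have h1 : capFraction n α ≤ 1 := by
    rw [← capFraction_pi n]; exact capFraction_mono hα (by linarith) le_rfl
  have : β = Real.pi - α := by linarith
  rw [this, capFraction_pi_sub]
  nlinarith

/-- `ballOverlap` is a lower bound for `capSum`. At a minimiser of `capSum` with positive angles the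
critical point equation is the law of sines, and `ballOverlap_eq_capSum` applies; at a degenerate
minimiser `capSum` is at least the smallest of the three coefficients. -/
lemma ballOverlap_le_capSum {n : ℕ} (hn : 1 ≤ n) {a b c θ₁ θ₂ θ₃ : ℝ} (ha : 0 < a) (hb : 0 < b)
    (hc : 0 < c) (h₁ : 0 ≤ θ₁) (h₂ : 0 ≤ θ₂) (h₃ : 0 ≤ θ₃) (hsum : θ₁ + θ₂ + θ₃ = Real.pi) :
    ballOverlap n a b c ≤ capSum n a b c θ₁ θ₂ θ₃ := by
  obtain ⟨φ₁, φ₂, φ₃, h1, h2, h3, hs, hmin⟩ := exists_capSum_min n a b c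
  refine le_trans ?_ (hmin θ₁ θ₂ θ₃ h₁ h₂ h₃ hsum)
  have hfa := ballOverlap_le_fst hn ha hb hc
  have hfb : ballOverlap n a b c ≤ b := by
    rw [ballOverlap_swap]; exact ballOverlap_le_fst hn hb ha hc
  have hfc := ballOverlap_le_thd hn ha hb hc
  rcases h1.eq_or_lt with h1 | h1
  · subst h1
    rw [capSum, capFraction_zero, mul_zero, zero_add]
    exact le_mul_capFraction_add hfb hfc h2 h3 (by linarith)
  rcases h2.eq_or_lt with h2 | h2
  · subst h2
    rw [capSum, capFraction_zero, mul_zero, add_zero]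
    exact le_mul_capFraction_add hfa hfc h1.le h3 (by linarith)
  rcases h3.eq_or_lt with h3 | h3
  · subst h3
    rw [capSum, capFraction_zero, mul_zero, add_zero]
    exact le_mul_capFraction_add hfa hfb h1.le h2.le (by linarith)
  obtain ⟨e1, e2⟩ := mul_sin_pow_eq_of_isMinOn h1 h2 h3 hs hmin
  have m1 : φ₁ ∈ Ioo 0 Real.pi := ⟨h1, by linarith⟩
  have m2 : φ₂ ∈ Ioo 0 Real.pi := ⟨h2, by linarith⟩
  have m3 : φ₃ ∈ Ioo 0 Real.pi := ⟨h3, by linarith⟩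
  have hs3 := Real.sin_pos_of_mem_Ioo m3
  have hκ : 0 < massRadius n c / Real.sin φ₃ := div_pos (massRadius_pos hc) hs3
  have hR3 : massRadius n c = massRadius n c / Real.sin φ₃ * Real.sin φ₃ := by field_simp
  exact (ballOverlap_eq_capSum hn ha hb hc hκ m1 m2 m3 hs
    (massRadius_eq_of_mul_sin_pow hn ha hc m1 m3 hκ e1 hR3)
    (massRadius_eq_of_mul_sin_pow hn hb hc m2 m3 hκ e2 hR3) hR3).le

/-- Three positive numbers satisfying the strict triangle inequalities are the sides of a
triangle. -/
lemma exists_triangle_angles {R₁ R₂ R₃ : ℝ} (h₁ : 0 < R₁) (h₂ : 0 < R₂) (h₃ : 0 < R₃)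
    (t₁ : R₁ < R₂ + R₃) (t₂ : R₂ < R₁ + R₃) (t₃ : R₃ < R₁ + R₂) :
    ∃ θ₁ θ₂ θ₃ κ : ℝ, θ₁ ∈ Ioo 0 Real.pi ∧ θ₂ ∈ Ioo 0 Real.pi ∧ θ₃ ∈ Ioo 0 Real.pi ∧
      θ₁ + θ₂ + θ₃ = Real.pi ∧ 0 < κ ∧
      R₁ = κ * Real.sin θ₁ ∧ R₂ = κ * Real.sin θ₂ ∧ R₃ = κ * Real.sin θ₃ := by
  obtain ⟨C, hC⟩ : ∃ C, C = (R₁ ^ 2 + R₂ ^ 2 - R₃ ^ 2) / (2 * R₁ * R₂) := ⟨_, rfl⟩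
  have hC' : R₃ ^ 2 = R₁ ^ 2 + R₂ ^ 2 - 2 * R₁ * R₂ * C := by rw [hC]; field_simp; ring
  have hC1 : C < 1 := by
    rw [hC, div_lt_one (by positivity)]
    nlinarith
  have hC2 : -1 < C := by
    rw [hC, lt_div_iff₀ (by positivity)]
    nlinarith
  have hθ₃ : Real.arccos C ∈ Ioo 0 Real.pi :=
    ⟨Real.arccos_pos.2 hC1, lt_of_le_of_ne (Real.arccos_le_pi _) fun h => by
      rw [Real.arccos_eq_pi] at h; linarith⟩
  have hs₃ := Real.sin_pos_of_mem_Ioo hθ₃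
  have hc₃ : Real.cos (Real.arccos C) = C := Real.cos_arccos hC2.le hC1.le
  have hsc₃ := Real.sin_sq_add_cos_sq (Real.arccos C)
  set θ₃ := Real.arccos C
  -- the second angle has cosine `D`, the projection of the side `R₃` to the side `R₁`
  obtain ⟨D, hD⟩ : ∃ D, D = (R₁ - R₂ * C) / R₃ := ⟨_, rfl⟩
  have hD' : R₃ * D = R₁ - R₂ * C := by rw [hD]; field_simp
  have hDsq : (R₃ * D) ^ 2 + (R₂ * Real.sin θ₃) ^ 2 = R₃ ^ 2 := by
    rw [hD', hC', mul_pow R₂]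
    have : Real.sin θ₃ ^ 2 = 1 - C ^ 2 := by rw [← hc₃]; linarith
    rw [this]; ring
  have hDsq' : R₃ ^ 2 * (1 - D ^ 2) = (R₂ * Real.sin θ₃) ^ 2 := by linarith
  have hDabs : D ^ 2 < 1 := by
    have : 0 < R₃ ^ 2 * (1 - D ^ 2) := by rw [hDsq']; positivity
    have := pos_of_mul_pos_right this (by positivity)
    linarith
  have hD1 : D < 1 := by nlinarith
  have hD2 : -1 < D := by nlinarith
  have hθ₂ : Real.arccos D ∈ Ioo 0 Real.pi :=
    ⟨Real.arccos_pos.2 hD1, lt_of_le_of_ne (Real.arccos_le_pi _) fun h => by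
      rw [Real.arccos_eq_pi] at h; linarith⟩
  have hs₂ := Real.sin_pos_of_mem_Ioo hθ₂
  have hc₂ : Real.cos (Real.arccos D) = D := Real.cos_arccos hD2.le hD1.le
  have hsc₂ := Real.sin_sq_add_cos_sq (Real.arccos D)
  set θ₂ := Real.arccos D
  have hsin : R₃ * Real.sin θ₂ = R₂ * Real.sin θ₃ := by
    refine (pow_left_inj₀ (by positivity) (by positivity) two_ne_zero).1 ?_
    rw [← hDsq', mul_pow]
    have : Real.sin θ₂ ^ 2 = 1 - D ^ 2 := by rw [← hc₂]; linarith
    rw [this]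
  have hsin₁ : R₃ * Real.sin (Real.pi - θ₂ - θ₃) = R₁ * Real.sin θ₃ := by
    rw [sub_sub, Real.sin_pi_sub, Real.sin_add, hc₂, hc₃]
    linear_combination C * hsin + Real.sin θ₃ * hD'
  have hs₁ : 0 < Real.sin (Real.pi - θ₂ - θ₃) := by
    have : 0 < R₃ * Real.sin (Real.pi - θ₂ - θ₃) := by rw [hsin₁]; positivity
    exact pos_of_mul_pos_right this h₃.le
  have hθ₁ : Real.pi - θ₂ - θ₃ ∈ Ioo 0 Real.pi := by
    refine ⟨?_, by linarith [hθ₂.1, hθ₃.1]⟩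
    by_contra! h
    have := Real.sin_nonpos_of_nonpos_of_neg_pi_le h (by linarith [hθ₂.2, hθ₃.2])
    linarith
  refine ⟨_, θ₂, θ₃, R₃ / Real.sin θ₃, hθ₁, hθ₂, hθ₃, by ring, by positivity, ?_, ?_, ?_⟩
  · field_simp; linarith
  · field_simp; linarith
  · field_simp

lemma capSum_combination (n : ℕ) (a₀ b₀ a₁ b₁ c θ₁ θ₂ θ₃ : ℝ) {s t : ℝ} (hst : s + t = 1) :
    capSum n (s * a₀ + t * a₁) (s * b₀ + t * b₁) c θ₁ θ₂ θ₃
      = s * capSum n a₀ b₀ c θ₁ θ₂ θ₃ + t * capSum n a₁ b₁ c θ₁ θ₂ θ₃ := by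
  have : t = 1 - s := by linarith
  subst this
  unfold capSum
  ring

/-- `ballOverlap` is strictly concave in its first two arguments where the three radii are the sides
of a nondegenerate triangle: equality in `ballOverlap_le_capSum` determines the arguments. -/
lemma ballOverlap_strictConcave {n : ℕ} (hn : 1 ≤ n) {a₀ b₀ a₁ b₁ c s t : ℝ} (ha₀ : 0 < a₀)
    (hb₀ : 0 < b₀) (ha₁ : 0 < a₁) (hb₁ : 0 < b₁) (hc : 0 < c) (hs : 0 < s) (ht : 0 < t)
    (hst : s + t = 1) (hne : a₀ ≠ a₁)
    (t₁ : massRadius n (s * a₀ + t * a₁) < massRadius n (s * b₀ + t * b₁) + massRadius n c)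
    (t₂ : massRadius n (s * b₀ + t * b₁) < massRadius n (s * a₀ + t * a₁) + massRadius n c)
    (t₃ : massRadius n c < massRadius n (s * a₀ + t * a₁) + massRadius n (s * b₀ + t * b₁)) :
    s * ballOverlap n a₀ b₀ c + t * ballOverlap n a₁ b₁ c
      < ballOverlap n (s * a₀ + t * a₁) (s * b₀ + t * b₁) c := by
  have ha : 0 < s * a₀ + t * a₁ := by positivity
  have hb : 0 < s * b₀ + t * b₁ := by positivity
  obtain ⟨θ₁, θ₂, θ₃, κ, m1, m2, m3, hsum, hκ, e1, e2, e3⟩ :=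
    exists_triangle_angles (massRadius_pos ha) (massRadius_pos hb) (massRadius_pos hc) t₁ t₂ t₃
  rw [ballOverlap_eq_capSum hn ha hb hc hκ m1 m2 m3 hsum e1 e2 e3, capSum_combination _ _ _ _ _ _
    _ _ _ hst]
  have hstrict : ballOverlap n a₀ b₀ c < capSum n a₀ b₀ c θ₁ θ₂ θ₃ := by
    refine lt_of_le_of_ne (ballOverlap_le_capSum hn ha₀ hb₀ hc m1.1.le m2.1.le m3.1.le hsum) ?_
    intro heq
    have hmin := (mul_sin_pow_eq_of_isMinOn (a := a₀) (b := b₀) (c := c) m1.1 m2.1 m3.1 hsum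
      fun φ₁ φ₂ φ₃ h1 h2 h3 h => heq ▸ ballOverlap_le_capSum hn ha₀ hb₀ hc h1 h2 h3 h).1
    have hA := mul_sin_pow_eq_of_massRadius hn ha e1
    have hC := mul_sin_pow_eq_of_massRadius hn hc e3
    have hs1 := Real.sin_pos_of_mem_Ioo m1
    have hv := unitBallVolume_pos n
    have h1 : a₀ * (Real.sin θ₁ ^ n * (unitBallVolume n * κ ^ n))
        = (s * a₀ + t * a₁) * (Real.sin θ₁ ^ n * (unitBallVolume n * κ ^ n)) := by
      linear_combination (unitBallVolume n * κ ^ n) * hmin + hC - hA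
    have h2 := mul_right_cancel₀ (by positivity) h1
    have hs' : s = 1 - t := by linarith
    rw [hs'] at h2
    exact hne (mul_left_cancel₀ ht.ne' (by linarith))
  have := ballOverlap_le_capSum hn ha₁ hb₁ hc m1.1.le m2.1.le m3.1.le hsum
  nlinarith

lemma ballOverlap_concave {n : ℕ} (hn : 1 ≤ n) {a₀ b₀ a₁ b₁ c s t : ℝ} (ha₀ : 0 < a₀)
    (hb₀ : 0 < b₀) (ha₁ : 0 < a₁) (hb₁ : 0 < b₁) (hc : 0 < c) (hs : 0 < s) (ht : 0 < t)
    (hst : s + t = 1) :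
    s * ballOverlap n a₀ b₀ c + t * ballOverlap n a₁ b₁ c
      ≤ ballOverlap n (s * a₀ + t * a₁) (s * b₀ + t * b₁) c := by
  have ha : 0 < s * a₀ + t * a₁ := by positivity
  have hb : 0 < s * b₀ + t * b₁ := by positivity
  rcases le_or_gt (massRadius n (s * b₀ + t * b₁) + massRadius n c)
    (massRadius n (s * a₀ + t * a₁)) with d | t₁
  · rw [ballOverlap_eq_fst hn hb hc d]
    nlinarith [ballOverlap_le_fst hn ha₀ hb₀ hc, ballOverlap_le_fst hn ha₁ hb₁ hc]
  rcases le_or_gt (massRadius n (s * a₀ + t * a₁) + massRadius n c)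
    (massRadius n (s * b₀ + t * b₁)) with d | t₂
  · rw [ballOverlap_swap n (s * a₀ + t * a₁), ballOverlap_eq_fst hn ha hc d, ballOverlap_swap n a₀,
      ballOverlap_swap n a₁]
    nlinarith [ballOverlap_le_fst hn hb₀ ha₀ hc, ballOverlap_le_fst hn hb₁ ha₁ hc]
  rcases le_or_gt (massRadius n (s * a₀ + t * a₁) + massRadius n (s * b₀ + t * b₁))
    (massRadius n c) with d | t₃
  · rw [ballOverlap_eq_thd hn ha hb d]
    have : c = s * c + t * c := by rw [← add_mul, hst, one_mul]
    nlinarith [ballOverlap_le_thd hn ha₀ hb₀ hc, ballOverlap_le_thd hn ha₁ hb₁ hc]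
  obtain ⟨θ₁, θ₂, θ₃, κ, m1, m2, m3, hsum, hκ, e1, e2, e3⟩ :=
    exists_triangle_angles (massRadius_pos ha) (massRadius_pos hb) (massRadius_pos hc) t₁ t₂ t₃
  rw [ballOverlap_eq_capSum hn ha hb hc hκ m1 m2 m3 hsum e1 e2 e3, capSum_combination _ _ _ _ _ _
    _ _ _ hst]
  have h0 := ballOverlap_le_capSum hn ha₀ hb₀ hc m1.1.le m2.1.le m3.1.le hsum
  have h1 := ballOverlap_le_capSum hn ha₁ hb₁ hc m1.1.le m2.1.le m3.1.le hsum
  nlinarith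

/-! ### Height functions -/

/-- The mass `∫ min(ρ, η)` of `ρ` below the level `η`; the height function is its inverse. -/
noncomputable def truncatedMass {n : ℕ} (ρ : Space n → ℝ) (η : ℝ) : ℝ := ∫ x, min (ρ x) η

section Height

variable {n : ℕ} {ρ : Space n → ℝ}

lemma IsProbDensity.integrable_min (hρ : IsProbDensity ρ) {η : ℝ} (hη : 0 ≤ η) :
    Integrable fun x => min (ρ x) η := by
  refine hρ.integrable.mono' (hρ.integrable.aestronglyMeasurable.inf aestronglyMeasurable_const)
    (Filter.Eventually.of_forall fun x => ?_)
  rw [Real.norm_eq_abs, abs_of_nonneg (le_min (hρ.nonneg x) hη)]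
  exact min_le_left _ _

lemma truncatedMass_mono (hρ : IsProbDensity ρ) {η₁ η₂ : ℝ} (h₁ : 0 ≤ η₁) (h : η₁ ≤ η₂) :
    truncatedMass ρ η₁ ≤ truncatedMass ρ η₂ :=
  integral_mono (hρ.integrable_min h₁) (hρ.integrable_min (h₁.trans h))
    fun _ => min_le_min_left _ h

lemma truncatedMass_le_one (hρ : IsProbDensity ρ) {η : ℝ} (h : 0 ≤ η) : truncatedMass ρ η ≤ 1 := by
  rw [← hρ.integral_eq_one]
  exact integral_mono (hρ.integrable_min h) hρ.integrable fun _ => min_le_left _ _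

lemma truncatedMass_zero (hρ : IsProbDensity ρ) : truncatedMass ρ 0 = 0 := by
  simp [truncatedMass, min_eq_right (hρ.nonneg _)]

lemma truncatedMass_eq_one (hρ : IsProbDensity ρ) (hdec : RadiallyDecreasing ρ) {η : ℝ}
    (h : ρ 0 ≤ η) : truncatedMass ρ η = 1 := by
  rw [← hρ.integral_eq_one]
  exact integral_congr_ae (Filter.Eventually.of_forall fun x =>
    min_eq_left ((hdec 0 x (by simp)).trans h))

lemma continuousOn_truncatedMass (hρ : IsProbDensity ρ) :
    ContinuousOn (truncatedMass ρ) (Ici 0) := by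
  refine continuousOn_of_dominated (bound := ρ)
    (fun η hη => (hρ.integrable_min hη).aestronglyMeasurable) (fun η hη => ?_) hρ.integrable ?_
  · refine Filter.Eventually.of_forall fun x => ?_
    rw [Real.norm_eq_abs, abs_of_nonneg (le_min (hρ.nonneg x) hη)]
    exact min_le_left _ _
  · exact Filter.Eventually.of_forall fun x => by fun_prop

lemma truncatedMass_strict (hρ : IsProbDensity ρ) {η₁ η₂ : ℝ} (h₁ : 0 ≤ η₁) (h : η₁ < η₂)
    (hlt : truncatedMass ρ η₁ < 1) : truncatedMass ρ η₁ < truncatedMass ρ η₂ := by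
  refine lt_of_le_of_ne (truncatedMass_mono hρ h₁ h.le) fun heq => hlt.ne ?_
  have h0 : ∫ x, (min (ρ x) η₂ - min (ρ x) η₁) = 0 := by
    rw [integral_sub (hρ.integrable_min (h₁.trans h.le)) (hρ.integrable_min h₁)]
    exact sub_eq_zero.2 heq.symm
  rw [integral_eq_zero_iff_of_nonneg (fun x => sub_nonneg.2 (min_le_min_left _ h.le))
    ((hρ.integrable_min (h₁.trans h.le)).sub (hρ.integrable_min h₁))] at h0
  rw [← hρ.integral_eq_one]
  refine integral_congr_ae ?_
  filter_upwards [h0] with x hx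
  simp only [Pi.zero_apply, sub_eq_zero] at hx
  refine min_eq_left ?_
  by_contra! hlt'
  rw [min_eq_right hlt'.le] at hx
  exact absurd hx (lt_min hlt' h).ne'

lemma volume_superlevel_lt_top (hρ : IsProbDensity ρ) {η : ℝ} (hη : 0 < η) :
    volume {x | η ≤ ρ x} < ⊤ := hρ.integrable.measure_ge_lt_top hη

lemma mul_volume_real_superlevel_le (hρ : IsProbDensity ρ) (η : ℝ) :
    η * volume.real {x | η ≤ ρ x} ≤ 1 := by
  rw [← hρ.integral_eq_one]
  exact mul_meas_ge_le_integral_of_nonneg (Filter.Eventually.of_forall hρ.nonneg) hρ.integrable η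

lemma truncatedMass_sub_le (hρ : IsProbDensity ρ) (hcont : Continuous ρ) {η₁ η₂ : ℝ} (h₁ : 0 < η₁)
    (h : η₁ ≤ η₂) : truncatedMass ρ η₂ - truncatedMass ρ η₁
      ≤ (η₂ - η₁) * volume.real {x | η₁ < ρ x} := by
  have hm : MeasurableSet {x | η₁ < ρ x} := (isOpen_lt continuous_const hcont).measurableSet
  have hfin : volume {x | η₁ < ρ x} ≠ ⊤ :=
    ((measure_mono fun x (hx : η₁ < ρ x) => hx.le).trans_lt (volume_superlevel_lt_top hρ h₁)).ne
  rw [truncatedMass, truncatedMass,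
    ← integral_sub (hρ.integrable_min (h₁.le.trans h)) (hρ.integrable_min h₁.le), mul_comm,
    ← smul_eq_mul, ← integral_indicator_const (μ := volume) _ hm]
  refine integral_mono ((hρ.integrable_min (h₁.le.trans h)).sub (hρ.integrable_min h₁.le))
    ((integrable_indicator_iff hm).2 (integrableOn_const hfin)) fun x => ?_
  simp only [indicator, mem_ofPred_eq]
  split_ifs with hx
  · rw [min_eq_right hx.le]
    linarith [min_le_right (ρ x) η₂]
  · push Not at hx
    rw [min_eq_left hx, min_eq_left (hx.trans h), sub_self]

lemma le_truncatedMass_sub (hρ : IsProbDensity ρ) (hcont : Continuous ρ) {η₁ η₂ : ℝ} (h₁ : 0 < η₁)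
    (h : η₁ ≤ η₂) : (η₂ - η₁) * volume.real {x | η₂ ≤ ρ x}
      ≤ truncatedMass ρ η₂ - truncatedMass ρ η₁ := by
  have hm : MeasurableSet {x | η₂ ≤ ρ x} := (isClosed_le continuous_const hcont).measurableSet
  have hfin := (volume_superlevel_lt_top hρ (h₁.trans_le h)).ne
  rw [truncatedMass, truncatedMass,
    ← integral_sub (hρ.integrable_min (h₁.le.trans h)) (hρ.integrable_min h₁.le), mul_comm,
    ← smul_eq_mul, ← integral_indicator_const (μ := volume) _ hm]
  refine integral_mono ((integrable_indicator_iff hm).2 (integrableOn_const hfin))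
    ((hρ.integrable_min (h₁.le.trans h)).sub (hρ.integrable_min h₁.le)) fun x => ?_
  simp only [indicator, mem_ofPred_eq]
  split_ifs with hx
  · rw [min_eq_right hx, min_eq_right (h.trans hx)]
  · exact sub_nonneg.2 (min_le_min_left _ h)

lemma heightFunction_eq (hρ : IsProbDensity ρ) {η s : ℝ} (hη : 0 < η) (hs : s < 1)
    (h : truncatedMass ρ η = s) : heightFunction ρ s = η := by
  have : {η : ℝ | 0 < η ∧ ∫ x, min (ρ x) η = s} = {η} := by
    ext ζ
    simp only [mem_ofPred_eq, mem_singleton_iff]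
    refine ⟨fun ⟨hζ, hζ'⟩ => ?_, fun hζ => hζ ▸ ⟨hη, h⟩⟩
    change truncatedMass ρ ζ = s at hζ'
    rcases lt_trichotomy ζ η with hlt | heq | hlt
    · exact absurd (truncatedMass_strict hρ hζ.le hlt (by linarith)) (by linarith)
    · exact heq
    · exact absurd (truncatedMass_strict hρ hη.le hlt (by linarith)) (by linarith)
  rw [heightFunction, this, csInf_singleton]

lemma heightFunction_spec (hρ : IsProbDensity ρ) (hdec : RadiallyDecreasing ρ) {s : ℝ}
    (hs : s ∈ Ioo (0 : ℝ) 1) :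
    0 < heightFunction ρ s ∧ truncatedMass ρ (heightFunction ρ s) = s := by
  have hρ0 : 0 ≤ ρ 0 := hρ.nonneg 0
  obtain ⟨η, hη, hη'⟩ := intermediate_value_Icc hρ0
    ((continuousOn_truncatedMass hρ).mono Icc_subset_Ici_self)
    (show s ∈ Icc (truncatedMass ρ 0) (truncatedMass ρ (ρ 0)) by
      rw [truncatedMass_zero hρ, truncatedMass_eq_one hρ hdec le_rfl]
      exact ⟨hs.1.le, hs.2.le⟩)
  have hpos : 0 < η := by
    refine lt_of_le_of_ne hη.1 fun h => ?_
    rw [← h, truncatedMass_zero hρ] at hη'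
    exact hs.1.ne hη'
  rw [heightFunction_eq hρ hpos hs.2 hη']
  exact ⟨hpos, hη'⟩

lemma heightFunction_lt (hρ : IsProbDensity ρ) (hdec : RadiallyDecreasing ρ) {s : ℝ}
    (hs : s ∈ Ioo (0 : ℝ) 1) : heightFunction ρ s < ρ 0 := by
  by_contra! h
  have := truncatedMass_eq_one hρ hdec h
  rw [(heightFunction_spec hρ hdec hs).2] at this
  exact hs.2.ne this

lemma monotoneOn_heightFunction (hρ : IsProbDensity ρ) (hdec : RadiallyDecreasing ρ) :
    MonotoneOn (heightFunction ρ) (Ioo 0 1) := by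
  intro s hs t ht hst
  by_contra! h
  obtain ⟨hs0, hs1⟩ := heightFunction_spec hρ hdec hs
  obtain ⟨ht0, ht1⟩ := heightFunction_spec hρ hdec ht
  have := truncatedMass_strict hρ ht0.le h (by rw [ht1]; exact ht.2)
  linarith

/-- The reciprocal of the slope of the height function is the volume of a superlevel set, which
Markov's inequality bounds. -/
lemma mul_sub_le_heightFunction_sub (hρ : IsProbDensity ρ) (hcont : Continuous ρ)
    (hdec : RadiallyDecreasing ρ) {s t : ℝ} (hs : s ∈ Ioo (0 : ℝ) 1) (ht : t ∈ Ioo (0 : ℝ) 1)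
    (hst : s ≤ t) :
    heightFunction ρ s * (t - s) ≤ heightFunction ρ t - heightFunction ρ s := by
  obtain ⟨hs0, hs1⟩ := heightFunction_spec hρ hdec hs
  obtain ⟨ht0, ht1⟩ := heightFunction_spec hρ hdec ht
  have hmono := monotoneOn_heightFunction hρ hdec hs ht hst
  have h1 := truncatedMass_sub_le hρ hcont hs0 hmono
  rw [hs1, ht1] at h1
  have h2 := mul_volume_real_superlevel_le hρ (heightFunction ρ s)
  have h3 : volume.real {x | heightFunction ρ s < ρ x}
      ≤ volume.real {x | heightFunction ρ s ≤ ρ x} :=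
    measureReal_mono (fun x (hx : _ < ρ x) => hx.le) (volume_superlevel_lt_top hρ hs0).ne
  have h4 : heightFunction ρ s * volume.real {x | heightFunction ρ s < ρ x} ≤ 1 :=
    (mul_le_mul_of_nonneg_left h3 hs0.le).trans h2
  calc heightFunction ρ s * (t - s) ≤ heightFunction ρ s *
        ((heightFunction ρ t - heightFunction ρ s) *
          volume.real {x | heightFunction ρ s < ρ x}) := mul_le_mul_of_nonneg_left h1 hs0.le
    _ = (heightFunction ρ t - heightFunction ρ s) *
        (heightFunction ρ s * volume.real {x | heightFunction ρ s < ρ x}) := by ring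
    _ ≤ (heightFunction ρ t - heightFunction ρ s) * 1 :=
        mul_le_mul_of_nonneg_left h4 (sub_nonneg.2 hmono)
    _ = _ := mul_one _

lemma exists_heightFunction_sub_le (hρ : IsProbDensity ρ) (hcont : Continuous ρ)
    (hdec : RadiallyDecreasing ρ) {r : ℝ} (hr : r ∈ Ioo (0 : ℝ) 1) :
    ∃ K : ℝ, 0 ≤ K ∧ ∀ s t, 0 < s → s ≤ t → t ≤ r →
      heightFunction ρ t - heightFunction ρ s ≤ K * (t - s) := by
  obtain ⟨hr0, -⟩ := heightFunction_spec hρ hdec hr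
  have hopen : IsOpen {x | heightFunction ρ r < ρ x} := isOpen_lt continuous_const hcont
  have hsub : volume {x | heightFunction ρ r ≤ ρ x} < ⊤ := volume_superlevel_lt_top hρ hr0
  have hpos : 0 < volume.real {x | heightFunction ρ r ≤ ρ x} := by
    refine ENNReal.toReal_pos (ne_of_gt ?_) hsub.ne
    exact (hopen.measure_pos volume ⟨0, heightFunction_lt hρ hdec hr⟩).trans_le
      (measure_mono fun x (hx : _ < ρ x) => hx.le)
  refine ⟨(volume.real {x | heightFunction ρ r ≤ ρ x})⁻¹, by positivity, ?_⟩
  intro s t hs hst htr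
  have hs' : s ∈ Ioo (0 : ℝ) 1 := ⟨hs, by linarith [hr.2]⟩
  have ht' : t ∈ Ioo (0 : ℝ) 1 := ⟨by linarith, by linarith [hr.2]⟩
  obtain ⟨hs0, hs1⟩ := heightFunction_spec hρ hdec hs'
  obtain ⟨ht0, ht1⟩ := heightFunction_spec hρ hdec ht'
  have hmono := monotoneOn_heightFunction hρ hdec hs' ht' hst
  have h1 := le_truncatedMass_sub hρ hcont hs0 hmono
  rw [hs1, ht1] at h1
  have h2 : volume.real {x | heightFunction ρ r ≤ ρ x}
      ≤ volume.real {x | heightFunction ρ t ≤ ρ x} :=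
    measureReal_mono
      (fun x (hx : _ ≤ ρ x) => (monotoneOn_heightFunction hρ hdec ht' hr htr).trans hx)
      (volume_superlevel_lt_top hρ ht0).ne
  rw [inv_mul_eq_div, le_div_iff₀ hpos]
  exact (mul_le_mul_of_nonneg_left h2 (sub_nonneg.2 hmono)).trans h1

lemma ae_hasDerivAt_heightFunction (hρ : IsProbDensity ρ) (hcont : Continuous ρ)
    (hdec : RadiallyDecreasing ρ) : ∀ᵐ s ∂volume.restrict (Ioo (0 : ℝ) 1),
      HasDerivAt (heightFunction ρ) (deriv (heightFunction ρ) s) s ∧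
        0 < deriv (heightFunction ρ) s := by
  filter_upwards [(monotoneOn_heightFunction hρ hdec).ae_differentiableWithinAt measurableSet_Ioo,
    ae_restrict_mem measurableSet_Ioo] with s hs hmem
  have hd : HasDerivAt (heightFunction ρ) (deriv (heightFunction ρ) s) s :=
    (hs.differentiableAt (isOpen_Ioo.mem_nhds hmem)).hasDerivAt
  refine ⟨hd, (heightFunction_spec hρ hdec hmem).1.trans_le ?_⟩
  have hslope := (hasDerivWithinAt_iff_tendsto_slope' (show s ∉ Ioi s from lt_irrefl s)).1
    (hd.hasDerivWithinAt (s := Ioi s))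
  refine ge_of_tendsto hslope ?_
  filter_upwards [Ioo_mem_nhdsGT hmem.2] with t ht
  rw [slope_def_field, le_div_iff₀ (sub_pos.2 ht.1)]
  exact mul_sub_le_heightFunction_sub hρ hcont hdec hmem ⟨hmem.1.trans ht.1, ht.2⟩ ht.1.le

lemma integrableOn_deriv_heightFunction (hρ : IsProbDensity ρ) (hdec : RadiallyDecreasing ρ) :
    IntegrableOn (deriv (heightFunction ρ)) (Ioo 0 1) := by
  -- extended by its bounds, the height function is monotone on the closed interval
  set g : ℝ → ℝ := fun s => if s ≤ 0 then 0 else if s < 1 then heightFunction ρ s else ρ 0 with hg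
  have hmono : MonotoneOn g (uIcc 0 1) := by
    intro s _ t _ hst
    simp only [hg]
    split_ifs with h1 h2 h3 h4 h5 h6
    · exact le_rfl
    · exact (heightFunction_spec hρ hdec ⟨not_le.1 h2, h3⟩).1.le
    · exact hρ.nonneg 0
    · linarith
    · exact monotoneOn_heightFunction hρ hdec ⟨not_le.1 h1, h4⟩ ⟨not_le.1 h5, h6⟩ hst
    · exact (heightFunction_lt hρ hdec ⟨not_le.1 h1, h4⟩).le
    all_goals linarith
  have h := (intervalIntegrable_iff_integrableOn_Ioo_of_le zero_le_one).1
    hmono.intervalIntegrable_deriv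
  refine h.congr_fun (fun s hs => ?_) measurableSet_Ioo
  refine Filter.EventuallyEq.deriv_eq ?_
  filter_upwards [isOpen_Ioo.mem_nhds hs] with t ht
  simp only [hg, not_le.2 ht.1, ht.2, if_false, if_true]

lemma exists_heightFunction_lt (hρ : IsProbDensity ρ) (hdec : RadiallyDecreasing ρ) {ε : ℝ}
    (hε : 0 < ε) : ∃ δ > 0, ∀ s ∈ Ioo (0 : ℝ) 1, s < δ → heightFunction ρ s < ε := by
  refine ⟨truncatedMass ρ ε, ?_, fun s hs hsδ => ?_⟩
  · have := truncatedMass_strict hρ le_rfl hε (by rw [truncatedMass_zero hρ]; exact one_pos)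
    rwa [truncatedMass_zero hρ] at this
  · by_contra! h
    have := truncatedMass_mono hρ hε.le h
    rw [(heightFunction_spec hρ hdec hs).2] at this
    linarith

lemma heightFunction_sub_eq_integral (hρ : IsProbDensity ρ) (hcont : Continuous ρ)
    (hdec : RadiallyDecreasing ρ) {s t : ℝ} (hs : 0 < s) (hst : s ≤ t) (ht : t < 1) :
    ∫ r in s..t, deriv (heightFunction ρ) r = heightFunction ρ t - heightFunction ρ s := by
  obtain ⟨K, hK, hlip⟩ := exists_heightFunction_sub_le hρ hcont hdec ⟨hs.trans_le hst, ht⟩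
  refine AbsolutelyContinuousOnInterval.integral_deriv_eq_sub ?_
  refine LipschitzOnWith.absolutelyContinuousOnInterval (K := K.toNNReal) ?_
  rw [uIcc_of_le hst]
  refine LipschitzOnWith.of_le_add_mul _ fun x hx y hy => ?_
  rw [Real.coe_toNNReal _ hK, Real.dist_eq]
  rcases le_total x y with h | h
  · have := monotoneOn_heightFunction hρ hdec ⟨hs.trans_le hx.1, hx.2.trans_lt ht⟩
      ⟨hs.trans_le hy.1, hy.2.trans_lt ht⟩ h
    have : 0 ≤ K * |x - y| := by positivity
    linarith
  · rw [abs_of_nonneg (sub_nonneg.2 h)]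
    linarith [hlip y x (hs.trans_le hy.1) h hx.2]

end Height

/-- The height function can be recovered from its derivative, being locally Lipschitz and tending
to `0` at `0`. -/
lemma heightFunction_eq_of_deriv_ae_eq {n : ℕ} {ρ₀ ρ₁ : Space n → ℝ}
    (hρ₀ : IsProbDensity ρ₀) (hρ₁ : IsProbDensity ρ₁) (hcont₀ : Continuous ρ₀)
    (hcont₁ : Continuous ρ₁) (hdec₀ : RadiallyDecreasing ρ₀) (hdec₁ : RadiallyDecreasing ρ₁)
    (h : ∀ᵐ s ∂volume.restrict (Ioo (0 : ℝ) 1),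
      deriv (heightFunction ρ₀) s = deriv (heightFunction ρ₁) s) {s : ℝ}
    (hs : s ∈ Ioo (0 : ℝ) 1) : heightFunction ρ₀ s = heightFunction ρ₁ s := by
  have hconst : ∀ r, 0 < r → r ≤ s → heightFunction ρ₀ s - heightFunction ρ₀ r
      = heightFunction ρ₁ s - heightFunction ρ₁ r := by
    intro r hr hrs
    rw [← heightFunction_sub_eq_integral hρ₀ hcont₀ hdec₀ hr hrs hs.2,
      ← heightFunction_sub_eq_integral hρ₁ hcont₁ hdec₁ hr hrs hs.2]
    rw [intervalIntegral.integral_of_le hrs, intervalIntegral.integral_of_le hrs]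
    exact integral_congr_ae (ae_restrict_of_ae_restrict_of_subset
      (fun x (hx : x ∈ Ioc r s) => (⟨hr.trans hx.1, hx.2.trans_lt hs.2⟩ : x ∈ Ioo (0 : ℝ) 1)) h)
  have habs : ∀ ε > 0, |heightFunction ρ₀ s - heightFunction ρ₁ s| < ε := by
    intro ε hε
    obtain ⟨δ₀, hδ₀, h₀⟩ := exists_heightFunction_lt hρ₀ hdec₀ hε
    obtain ⟨δ₁, hδ₁, h₁⟩ := exists_heightFunction_lt hρ₁ hdec₁ hε
    obtain ⟨r, hr0, hr⟩ := exists_between (lt_min (lt_min hδ₀ hδ₁) hs.1)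
    obtain ⟨hr', hrs⟩ := lt_min_iff.1 hr
    obtain ⟨hr₀, hr₁⟩ := lt_min_iff.1 hr'
    have hrm : r ∈ Ioo (0 : ℝ) 1 := ⟨hr0, hrs.trans hs.2⟩
    have := hconst r hr0 hrs.le
    rw [abs_lt]
    constructor <;> linarith [h₀ r hrm hr₀, h₁ r hrm hr₁, (heightFunction_spec hρ₀ hdec₀ hrm).1,
      (heightFunction_spec hρ₁ hdec₁ hrm).1]
  exact sub_eq_zero.1 (abs_eq_zero.1 (le_antisymm (le_of_forall_pos_lt_add fun ε hε => by
    simpa using habs ε hε) (abs_nonneg _)))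

/-- The masses below all levels determine the volumes of the superlevel sets, hence the density. -/
lemma le_of_truncatedMass_eq {n : ℕ} (hn : 1 ≤ n) {ρ₀ ρ₁ : Space n → ℝ}
    (hρ₀ : IsProbDensity ρ₀) (hρ₁ : IsProbDensity ρ₁) (hcont₀ : Continuous ρ₀)
    (hcont₁ : Continuous ρ₁) (hdec₀ : RadiallyDecreasing ρ₀) (hdec₁ : RadiallyDecreasing ρ₁)
    (h : ∀ η > 0, truncatedMass ρ₀ η = truncatedMass ρ₁ η) (x : Space n) : ρ₀ x ≤ ρ₁ x := by
  by_contra! hlt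
  have : Nonempty (Fin n) := ⟨⟨0, hn⟩⟩
  obtain ⟨η₁, h1, h1'⟩ := exists_between hlt
  obtain ⟨η₂, h2, h2'⟩ := exists_between h1'
  have hη₁ : 0 < η₁ := (hρ₁.nonneg x).trans_lt h1
  -- by continuity `ρ₀` exceeds `η₂` on a ball of radius larger than `‖x‖`
  obtain ⟨y, hxy, hy⟩ : ∃ y : Space n, ‖x‖ < ‖y‖ ∧ η₂ < ρ₀ y := by
    obtain ⟨e, he⟩ := exists_norm_eq (Space n) (zero_le_one (α := ℝ))
    by_cases hx : x = 0
    · subst hx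
      have ht : Filter.Tendsto (fun ε : ℝ => ρ₀ (ε • e)) (nhdsWithin 0 (Ioi 0)) (nhds (ρ₀ 0)) := by
        have : Continuous fun ε : ℝ => ρ₀ (ε • e) := by fun_prop
        simpa using (this.tendsto 0).mono_left nhdsWithin_le_nhds
      obtain ⟨ε, hε, hε'⟩ := ((ht.eventually (lt_mem_nhds h2')).and self_mem_nhdsWithin).exists
      refine ⟨ε • e, ?_, hε⟩
      rw [norm_zero, norm_smul, he, mul_one]
      exact norm_pos_iff.2 (ne_of_gt hε')
    · have ht : Filter.Tendsto (fun r : ℝ => ρ₀ (r • x)) (nhdsWithin 1 (Ioi 1))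
          (nhds (ρ₀ x)) := by
        have : Continuous fun r : ℝ => ρ₀ (r • x) := by fun_prop
        simpa using (this.tendsto 1).mono_left nhdsWithin_le_nhds
      obtain ⟨r, hr, hr'⟩ := ((ht.eventually (lt_mem_nhds h2')).and self_mem_nhdsWithin).exists
      refine ⟨r • x, ?_, hr⟩
      have hr1 : 1 < r := hr'
      rw [norm_smul, Real.norm_eq_abs, abs_of_pos (by linarith)]
      nlinarith [norm_pos_iff.2 hx]
  have hA := le_truncatedMass_sub hρ₀ hcont₀ hη₁ h2.le
  have hB := truncatedMass_sub_le hρ₁ hcont₁ hη₁ h2.le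
  rw [h η₁ hη₁, h η₂ (hη₁.trans h2)] at hA
  have hA' : volume.real (Metric.ball (0 : Space n) ‖y‖) ≤ volume.real {z | η₂ ≤ ρ₀ z} := by
    refine measureReal_mono (fun z hz => ?_) (volume_superlevel_lt_top hρ₀ (hη₁.trans h2)).ne
    exact hy.le.trans (hdec₀ z y (mem_ball_zero_iff.1 hz).le)
  have hB' : volume.real {z | η₁ < ρ₁ z} ≤ volume.real (Metric.ball (0 : Space n) ‖x‖) := by
    refine measureReal_mono (fun z hz => ?_) measure_ball_lt_top.ne
    rw [mem_ball_zero_iff]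
    by_contra! hz'
    have := hdec₁ x z hz'
    have hz'' : η₁ < ρ₁ z := hz
    linarith
  have hball : volume.real (Metric.ball (0 : Space n) ‖x‖)
      < volume.real (Metric.ball (0 : Space n) ‖y‖) := by
    rw [measureReal_def, measureReal_def, Measure.addHaar_ball _ _ (norm_nonneg x),
      Measure.addHaar_ball _ _ (norm_nonneg y), ENNReal.toReal_mul, ENNReal.toReal_mul,
      ENNReal.toReal_ofReal (by positivity), ENNReal.toReal_ofReal (by positivity),
      finrank_euclideanSpace, Fintype.card_fin]
    exact mul_lt_mul_of_pos_right (pow_lt_pow_left₀ hxy (norm_nonneg x) (by omega))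
      (unitBallVolume_pos n)
  have := hA.trans hB
  rw [mul_le_mul_iff_right₀ (sub_pos.2 h2)] at this
  linarith

lemma eq_of_deriv_heightFunction_ae_eq {n : ℕ} (hn : 1 ≤ n) {ρ₀ ρ₁ : Space n → ℝ}
    (hρ₀ : IsProbDensity ρ₀) (hρ₁ : IsProbDensity ρ₁) (hcont₀ : Continuous ρ₀)
    (hcont₁ : Continuous ρ₁) (hdec₀ : RadiallyDecreasing ρ₀) (hdec₁ : RadiallyDecreasing ρ₁)
    (h : ∀ᵐ s ∂volume.restrict (Ioo (0 : ℝ) 1),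
      deriv (heightFunction ρ₀) s = deriv (heightFunction ρ₁) s) : ρ₀ = ρ₁ := by
  have hh : ∀ s ∈ Ioo (0 : ℝ) 1, heightFunction ρ₀ s = heightFunction ρ₁ s := fun s hs =>
    heightFunction_eq_of_deriv_ae_eq hρ₀ hρ₁ hcont₀ hcont₁ hdec₀ hdec₁ h hs
  have key : ∀ {ρ ρ' : Space n → ℝ}, IsProbDensity ρ → IsProbDensity ρ' → RadiallyDecreasing ρ' →
      (∀ s ∈ Ioo (0 : ℝ) 1, heightFunction ρ s = heightFunction ρ' s) → ∀ η > 0,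
      truncatedMass ρ η < 1 → truncatedMass ρ' η = truncatedMass ρ η := by
    intro ρ ρ' hρ hρ' hdec' heq η hη hlt
    have hpos : 0 < truncatedMass ρ η := by
      have := truncatedMass_strict hρ le_rfl hη (by rw [truncatedMass_zero hρ]; exact one_pos)
      rwa [truncatedMass_zero hρ] at this
    have h1 := heightFunction_eq hρ hη hlt rfl
    have h2 := (heightFunction_spec hρ' hdec' ⟨hpos, hlt⟩).2
    rwa [← heq _ ⟨hpos, hlt⟩, h1] at h2
  have hm : ∀ η > 0, truncatedMass ρ₀ η = truncatedMass ρ₁ η := by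
    intro η hη
    rcases (truncatedMass_le_one hρ₀ hη.le).lt_or_eq with h0 | h0
    · exact (key hρ₀ hρ₁ hdec₁ hh η hη h0).symm
    rcases (truncatedMass_le_one hρ₁ hη.le).lt_or_eq with h1 | h1
    · exact key hρ₁ hρ₀ hdec₀ (fun s hs => (hh s hs).symm) η hη h1
    · rw [h0, h1]
  funext x
  exact le_antisymm (le_of_truncatedMass_eq hn hρ₀ hρ₁ hcont₀ hcont₁ hdec₀ hdec₁ hm x)
    (le_of_truncatedMass_eq hn hρ₁ hρ₀ hcont₁ hcont₀ hdec₁ hdec₀ (fun η hη => (hm η hη).symm) x)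

/-! ### Superpositions of uniform densities on balls -/

/-- A measurable, positive and integrable function on `(0, 1)`, as is the derivative of a height
function up to a null set. -/
structure IsHeightSlope (a : ℝ → ℝ) : Prop where
  measurable : Measurable a
  pos : ∀ s, 0 < a s
  integrable : IntegrableOn a (Ioo 0 1)

/-- The superposition over `s ∈ (0, 1)` of the uniform densities of height `a s` and of infinitesimal
mass `ds`. -/
noncomputable def layeredDensity (n : ℕ) (a : ℝ → ℝ) (x : Space n) : ℝ :=
  ∫ s in Ioo (0 : ℝ) 1, (Metric.ball (0 : Space n) (massRadius n (a s))).indicator (fun _ => a s) x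

lemma layeredDensity_congr {n : ℕ} {a b : ℝ → ℝ}
    (h : ∀ᵐ s ∂volume.restrict (Ioo (0 : ℝ) 1), a s = b s) :
    layeredDensity n a = layeredDensity n b := by
  funext x
  refine integral_congr_ae ?_
  filter_upwards [h] with s hs
  rw [hs]

/-- The mass that the pair density `ρ ⊗ ρ` gives to the pairs at distance less than `u`. -/
noncomputable def pairMass {n : ℕ} (ρ : Space n → ℝ) (u : ℝ) : ℝ :=
  ∫ p : Space n × Space n, {p : Space n × Space n | ‖p.1 - p.2‖ < u}.indicator
    (fun p => ρ p.1 * ρ p.2) p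

lemma measurable_massRadius (n : ℕ) : Measurable (massRadius n) := by
  unfold massRadius
  fun_prop

section Layers

variable {n : ℕ} {a : ℝ → ℝ}

/-- The density of the layer `s` at `x`. -/
noncomputable def layer (n : ℕ) (a : ℝ → ℝ) (s : ℝ) (x : Space n) : ℝ :=
  (Metric.ball (0 : Space n) (massRadius n (a s))).indicator (fun _ => a s) x

lemma layer_nonneg (ha : IsHeightSlope a) (s : ℝ) (x : Space n) : 0 ≤ layer n a s x :=
  indicator_nonneg (fun _ _ => (ha.pos s).le) x

lemma layer_le (ha : IsHeightSlope a) (s : ℝ) (x : Space n) : layer n a s x ≤ a s :=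
  indicator_apply_le' (fun _ => le_rfl) fun _ => (ha.pos s).le

lemma measurable_layer (ha : IsHeightSlope a) :
    Measurable fun q : ℝ × Space n => layer n a q.1 q.2 := by
  have h : (fun q : ℝ × Space n => layer n a q.1 q.2)
      = {q : ℝ × Space n | ‖q.2‖ < massRadius n (a q.1)}.indicator fun q => a q.1 := by
    funext q
    simp [layer, indicator]
  rw [h]
  have := measurable_massRadius n
  have := ha.measurable
  exact (by fun_prop : Measurable fun q : ℝ × Space n => a q.1).indicator
    (measurableSet_lt (by fun_prop) (by fun_prop))

lemma integrable_layer (ha : IsHeightSlope a) (x : Space n) :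
    IntegrableOn (fun s => layer n a s x) (Ioo 0 1) := by
  refine Integrable.mono' ha.integrable
    ((measurable_layer ha).comp (by fun_prop : Measurable fun s : ℝ => (s, x))).aestronglyMeasurable
    (Filter.Eventually.of_forall fun s => ?_)
  rw [Real.norm_eq_abs, abs_of_nonneg (layer_nonneg ha s x)]
  exact layer_le ha s x

lemma layeredDensity_nonneg (ha : IsHeightSlope a) (x : Space n) : 0 ≤ layeredDensity n a x :=
  integral_nonneg fun s => layer_nonneg ha s x

lemma layeredDensity_le (ha : IsHeightSlope a) (x : Space n) :
    layeredDensity n a x ≤ ∫ s in Ioo (0 : ℝ) 1, a s :=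
  integral_mono (integrable_layer ha x) ha.integrable fun s => layer_le ha s x

lemma ofReal_layeredDensity (ha : IsHeightSlope a) (x : Space n) :
    ENNReal.ofReal (layeredDensity n a x)
      = ∫⁻ s in Ioo (0 : ℝ) 1, ENNReal.ofReal (layer n a s x) :=
  ofReal_integral_eq_lintegral_ofReal (integrable_layer ha x)
    (Filter.Eventually.of_forall fun s => layer_nonneg ha s x)

lemma measurable_layeredDensity (ha : IsHeightSlope a) : Measurable (layeredDensity n a) := by
  have h : layeredDensity n a
      = fun x => (∫⁻ s in Ioo (0 : ℝ) 1, ENNReal.ofReal (layer n a s x)).toReal := by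
    funext x
    rw [← ofReal_layeredDensity ha, ENNReal.toReal_ofReal (layeredDensity_nonneg ha x)]
  rw [h]
  exact ((measurable_layer ha).ennreal_ofReal.lintegral_prod_left').ennreal_toReal

lemma lintegral_layer (hn : 1 ≤ n) (ha : IsHeightSlope a) (s : ℝ) :
    ∫⁻ x, ENNReal.ofReal (layer n a s x) = 1 := by
  have h : ∀ x, ENNReal.ofReal (layer n a s x)
      = (Metric.ball (0 : Space n) (massRadius n (a s))).indicator
        (fun _ => ENNReal.ofReal (a s)) x := by
    intro x
    unfold layer indicator
    split_ifs <;> simp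
  simp only [h]
  rw [lintegral_indicator_const measurableSet_ball,
    ← ENNReal.ofReal_toReal (a := volume _) measure_ball_lt_top.ne, ← measureReal_def,
    volume_real_ball_massRadius hn (ha.pos s), ← ENNReal.ofReal_mul (ha.pos s).le,
    mul_inv_cancel₀ (ha.pos s).ne', ENNReal.ofReal_one]

lemma lintegral_layeredDensity (hn : 1 ≤ n) (ha : IsHeightSlope a) :
    ∫⁻ x, ENNReal.ofReal (layeredDensity n a x) = 1 := by
  simp only [ofReal_layeredDensity ha]
  rw [lintegral_lintegral_swap]
  · simp [lintegral_layer hn ha]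
  · exact ((measurable_layer ha).ennreal_ofReal.comp measurable_swap).aemeasurable

lemma isProbDensity_layeredDensity (hn : 1 ≤ n) (ha : IsHeightSlope a) :
    IsProbDensity (layeredDensity n a) where
  nonneg := layeredDensity_nonneg ha
  integrable := by
    refine ⟨(measurable_layeredDensity ha).aestronglyMeasurable, ?_⟩
    rw [hasFiniteIntegral_iff_ofReal (Filter.Eventually.of_forall (layeredDensity_nonneg ha)),
      lintegral_layeredDensity hn ha]
    exact ENNReal.one_lt_top
  integral_eq_one := by
    rw [integral_eq_lintegral_of_nonneg_ae (Filter.Eventually.of_forall (layeredDensity_nonneg ha))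
      (measurable_layeredDensity ha).aestronglyMeasurable, lintegral_layeredDensity hn ha,
      ENNReal.toReal_one]

lemma measurable_volume_tripleSet (ha : IsHeightSlope a) (u : ℝ) :
    Measurable fun σ : ℝ × ℝ =>
      volume (tripleSet n (massRadius n (a σ.1)) (massRadius n (a σ.2)) u) := by
  have := measurable_massRadius n
  have := ha.measurable
  have hm : MeasurableSet {q : (ℝ × ℝ) × (Space n × Space n) |
      ‖q.2.1‖ < massRadius n (a q.1.1) ∧ ‖q.2.2‖ < massRadius n (a q.1.2)
        ∧ ‖q.2.1 - q.2.2‖ < u} := by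
    rw [ofPred_and, ofPred_and]
    exact (measurableSet_lt (by fun_prop) (by fun_prop)).inter
      ((measurableSet_lt (by fun_prop) (by fun_prop)).inter
        (measurableSet_lt (by fun_prop) (by fun_prop)))
  exact measurable_measure_prodMk_left hm

lemma measurable_ballOverlap (hn : 1 ≤ n) (ha : IsHeightSlope a) {u : ℝ} (hu : 0 < u) :
    Measurable fun σ : ℝ × ℝ => ballOverlap n (a σ.1) (a σ.2) (unitBallVolume n * u ^ n)⁻¹ := by
  unfold ballOverlap
  simp only [massRadius_inv hn hu]
  have := ha.measurable
  have := (measurable_volume_tripleSet (n := n) ha u).ennreal_toReal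
  simp only [measureReal_def]
  fun_prop

lemma integrable_ballOverlap (hn : 1 ≤ n) (ha : IsHeightSlope a) {u : ℝ} (hu : 0 < u) :
    Integrable (fun σ : ℝ × ℝ => ballOverlap n (a σ.1) (a σ.2) (unitBallVolume n * u ^ n)⁻¹)
      ((volume.restrict (Ioo 0 1)).prod (volume.restrict (Ioo 0 1))) := by
  have hc : 0 < (unitBallVolume n * u ^ n)⁻¹ := by have := unitBallVolume_pos n; positivity
  refine Integrable.mono' (integrable_const (unitBallVolume n * u ^ n)⁻¹)
    (measurable_ballOverlap hn ha hu).aestronglyMeasurable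
    (Filter.Eventually.of_forall fun σ => ?_)
  rw [Real.norm_eq_abs, abs_of_nonneg (ballOverlap_nonneg (ha.pos _) (ha.pos _) hc)]
  exact ballOverlap_le_thd hn (ha.pos _) (ha.pos _) hc

/-- By Tonelli, the pair mass is an average of the overlaps of the layers. -/
lemma pairMass_layeredDensity (hn : 1 ≤ n) (ha : IsHeightSlope a) {u : ℝ} (hu : 0 < u) :
    pairMass (layeredDensity n a) u = unitBallVolume n * u ^ n *
      ∫ σ, ballOverlap n (a σ.1) (a σ.2) (unitBallVolume n * u ^ n)⁻¹
        ∂((volume.restrict (Ioo 0 1)).prod (volume.restrict (Ioo 0 1))) := by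
  have hcu : 0 < unitBallVolume n * u ^ n := by have := unitBallVolume_pos n; positivity
  set μ : Measure ℝ := volume.restrict (Ioo 0 1) with hμ
  have hS : MeasurableSet {p : Space n × Space n | ‖p.1 - p.2‖ < u} :=
    (isOpen_lt (by fun_prop) (by fun_prop)).measurableSet
  have hρ := measurable_layeredDensity (n := n) ha
  rw [pairMass, ← integral_const_mul, integral_eq_lintegral_of_nonneg_ae,
    integral_eq_lintegral_of_nonneg_ae]
  · congr 1
    have hl : ∀ p : Space n × Space n, ENNReal.ofReal
        ({p : Space n × Space n | ‖p.1 - p.2‖ < u}.indicator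
          (fun p => layeredDensity n a p.1 * layeredDensity n a p.2) p)
        = ∫⁻ σ, {p : Space n × Space n | ‖p.1 - p.2‖ < u}.indicator (fun p =>
            ENNReal.ofReal (layer n a σ.1 p.1) * ENNReal.ofReal (layer n a σ.2 p.2)) p
          ∂(μ.prod μ) := by
      intro p
      have hlayer : ∀ x : Space n, AEMeasurable (fun s => ENNReal.ofReal (layer n a s x)) μ :=
        fun x => ((measurable_layer ha).comp
          (by fun_prop : Measurable fun s : ℝ => (s, x))).ennreal_ofReal.aemeasurable
      by_cases hp : p ∈ {p : Space n × Space n | ‖p.1 - p.2‖ < u}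
      · simp only [indicator_of_mem hp]
        rw [ENNReal.ofReal_mul (layeredDensity_nonneg ha _), ofReal_layeredDensity ha,
          ofReal_layeredDensity ha, lintegral_prod_mul (hlayer _) (hlayer _)]
      · simp only [indicator_of_notMem hp, ENNReal.ofReal_zero, lintegral_zero]
    simp only [hl]
    rw [lintegral_lintegral_swap]
    · refine lintegral_congr fun σ => ?_
      have hin : ∀ p : Space n × Space n, {p : Space n × Space n | ‖p.1 - p.2‖ < u}.indicator
          (fun p => ENNReal.ofReal (layer n a σ.1 p.1) * ENNReal.ofReal (layer n a σ.2 p.2)) p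
          = (tripleSet n (massRadius n (a σ.1)) (massRadius n (a σ.2)) u).indicator
            (fun _ => ENNReal.ofReal (a σ.1 * a σ.2)) p := by
        intro p
        simp only [indicator, layer, tripleSet, mem_ofPred_eq, mem_ball_zero_iff]
        by_cases h1 : ‖p.1‖ < massRadius n (a σ.1) <;>
          by_cases h2 : ‖p.2‖ < massRadius n (a σ.2) <;>
          by_cases h3 : ‖p.1 - p.2‖ < u <;> simp [h1, h2, h3, ENNReal.ofReal_mul (ha.pos _).le]
      simp only [hin]
      have hfin : volume (tripleSet n (massRadius n (a σ.1)) (massRadius n (a σ.2)) u) ≠ ⊤ :=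
        ((measure_mono tripleSet_subset_ball_prod).trans_lt
          (measure_ball_prod_ne_top _ _).lt_top).ne
      rw [lintegral_indicator_const (measurableSet_tripleSet n _ _ _), ballOverlap,
        massRadius_inv hn hu, ← ENNReal.ofReal_toReal hfin, ← measureReal_def,
        ← ENNReal.ofReal_mul (mul_pos (ha.pos _) (ha.pos _)).le]
      have := (unitBallVolume_pos n).ne'
      congr 1
      field_simp
    · have h1 := (measurable_layer (n := n) ha).ennreal_ofReal.comp
        (by fun_prop : Measurable fun q : (Space n × Space n) × (ℝ × ℝ) => (q.2.1, q.1.1))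
      have h2 := (measurable_layer (n := n) ha).ennreal_ofReal.comp
        (by fun_prop : Measurable fun q : (Space n × Space n) × (ℝ × ℝ) => (q.2.2, q.1.2))
      exact ((h1.mul h2).indicator (measurable_fst hS)).aemeasurable
  · exact Filter.Eventually.of_forall fun σ => mul_nonneg hcu.le
      (ballOverlap_nonneg (ha.pos _) (ha.pos _) (inv_pos.2 hcu))
  · exact ((measurable_ballOverlap hn ha hu).const_mul _).aestronglyMeasurable
  · exact Filter.Eventually.of_forall fun p => indicator_nonneg
      (fun p _ => mul_nonneg (layeredDensity_nonneg ha _) (layeredDensity_nonneg ha _)) p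
  · exact ((by fun_prop : Measurable fun p : Space n × Space n =>
      layeredDensity n a p.1 * layeredDensity n a p.2).indicator hS).aestronglyMeasurable

lemma IsHeightSlope.combination {b : ℝ → ℝ} (ha : IsHeightSlope a) (hb : IsHeightSlope b) {s t : ℝ}
    (hs : 0 ≤ s) (ht : 0 ≤ t) (hst : s + t = 1) : IsHeightSlope fun r => s * a r + t * b r where
  measurable := by
    have := ha.measurable
    have := hb.measurable
    fun_prop
  pos r := by
    rcases hs.eq_or_lt with rfl | hs
    · have : t = 1 := by linarith
      simpa [this] using hb.pos r
    · have := mul_pos hs (ha.pos r)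
      have := mul_nonneg ht (hb.pos r).le
      linarith
  integrable := (ha.integrable.const_mul s).add (hb.integrable.const_mul t)

lemma pairMass_concave (hn : 1 ≤ n) {b : ℝ → ℝ} (ha : IsHeightSlope a) (hb : IsHeightSlope b)
    {s t : ℝ} (hs : 0 < s) (ht : 0 < t) (hst : s + t = 1) {u : ℝ} (hu : 0 < u) :
    s * pairMass (layeredDensity n a) u + t * pairMass (layeredDensity n b) u
      ≤ pairMass (layeredDensity n fun r => s * a r + t * b r) u := by
  have hcu : 0 < unitBallVolume n * u ^ n := by have := unitBallVolume_pos n; positivity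
  have hab := ha.combination hb hs.le ht.le hst
  rw [pairMass_layeredDensity hn ha hu, pairMass_layeredDensity hn hb hu,
    pairMass_layeredDensity hn hab hu, mul_left_comm, mul_left_comm t, ← mul_add,
    mul_le_mul_iff_right₀ hcu, ← integral_const_mul, ← integral_const_mul,
    ← integral_add ((integrable_ballOverlap hn ha hu).const_mul _)
      ((integrable_ballOverlap hn hb hu).const_mul _)]
  exact integral_mono (((integrable_ballOverlap hn ha hu).const_mul _).add
    ((integrable_ballOverlap hn hb hu).const_mul _)) (integrable_ballOverlap hn hab hu)
    fun σ => ballOverlap_concave hn (ha.pos _) (ha.pos _) (hb.pos _) (hb.pos _) (inv_pos.2 hcu)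
      hs ht hst

/-- If two height slopes differ on a set of positive measure, then so they do on a set on which the
radii of the interpolated layers differ by a factor of at most `3 / 2`. For distances `u` comparable
to these radii, all pairs of such layers contribute a nondegenerate triangle. -/
lemma exists_pairMass_strictConcave (hn : 1 ≤ n) {b : ℝ → ℝ} (ha : IsHeightSlope a)
    (hb : IsHeightSlope b) {s t : ℝ} (hs : 0 < s) (ht : 0 < t) (hst : s + t = 1)
    (hne : ¬ ∀ᵐ r ∂volume.restrict (Ioo (0 : ℝ) 1), a r = b r) :
    ∃ α > 0, ∀ u ∈ Ioo (α / 2) (2 * α),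
      s * pairMass (layeredDensity n a) u + t * pairMass (layeredDensity n b) u
        < pairMass (layeredDensity n fun r => s * a r + t * b r) u := by
  set μ : Measure ℝ := volume.restrict (Ioo 0 1) with hμ
  have hab := ha.combination hb hs.le ht.le hst
  set R : ℝ → ℝ := fun r => massRadius n (s * a r + t * b r) with hR
  obtain ⟨k, hk⟩ : ∃ k : ℤ, 0 < μ {r | a r ≠ b r ∧ R r ∈ Ico ((3 / 2 : ℝ) ^ k)
      ((3 / 2 : ℝ) ^ (k + 1))} := by
    by_contra! h
    refine hne ?_
    rw [ae_iff]
    refine measure_mono_null (fun r hr => ?_)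
      (measure_iUnion_null fun k : ℤ => le_antisymm (h k) (zero_le))
    obtain ⟨k, hk⟩ := exists_mem_Ico_zpow (massRadius_pos (n := n) (hab.pos r))
      (by norm_num : (1 : ℝ) < 3 / 2)
    exact mem_iUnion.2 ⟨k, hr, hk⟩
  set E := {r | a r ≠ b r ∧ R r ∈ Ico ((3 / 2 : ℝ) ^ k) ((3 / 2 : ℝ) ^ (k + 1))} with hE
  have hα : (0 : ℝ) < (3 / 2) ^ k := by positivity
  rw [zpow_add_one₀ (by norm_num)] at hE
  refine ⟨(3 / 2) ^ k, hα, fun u hu => ?_⟩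
  set α : ℝ := (3 / 2) ^ k
  have hu0 : 0 < u := by linarith [hu.1]
  have hcu : 0 < unitBallVolume n * u ^ n := by have := unitBallVolume_pos n; positivity
  have hI : Integrable (fun σ : ℝ × ℝ =>
      s * ballOverlap n (a σ.1) (a σ.2) (unitBallVolume n * u ^ n)⁻¹
        + t * ballOverlap n (b σ.1) (b σ.2) (unitBallVolume n * u ^ n)⁻¹) (μ.prod μ) :=
    ((integrable_ballOverlap hn ha hu0).const_mul _).add
      ((integrable_ballOverlap hn hb hu0).const_mul _)
  rw [pairMass_layeredDensity hn ha hu0, pairMass_layeredDensity hn hb hu0,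
    pairMass_layeredDensity hn hab hu0, mul_left_comm, mul_left_comm t, ← mul_add,
    mul_lt_mul_iff_right₀ hcu, ← integral_const_mul, ← integral_const_mul,
    ← integral_add ((integrable_ballOverlap hn ha hu0).const_mul _)
      ((integrable_ballOverlap hn hb hu0).const_mul _), ← sub_pos, ← integral_sub
      (integrable_ballOverlap hn hab hu0) hI, integral_pos_iff_support_of_nonneg]
  · have hprod : 0 < (μ.prod μ) (E ×ˢ E) := by
      rw [Measure.prod_prod]
      exact ENNReal.mul_pos hk.ne' hk.ne'
    refine hprod.trans_le (measure_mono ?_)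
    rintro ⟨r, r'⟩ ⟨hr, hr'⟩
    rw [hE] at hr hr'
    have h1 := hr.2.1
    have h2 := hr.2.2
    have h3 := hr'.2.1
    have h4 := hr'.2.2
    have hu1 := hu.1
    have hu2 := hu.2
    simp only [hR] at h1 h2 h3 h4
    refine ne_of_gt (sub_pos.2 (ballOverlap_strictConcave hn (ha.pos _) (ha.pos _) (hb.pos _)
      (hb.pos _) (inv_pos.2 hcu) hs ht hst hr.1 ?_ ?_ ?_)) <;>
      simp only [massRadius_inv hn hu0] <;> linarith
  · exact fun σ => sub_nonneg.2 (ballOverlap_concave hn (ha.pos _) (ha.pos _) (hb.pos _)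
      (hb.pos _) (inv_pos.2 hcu) hs ht hst)
  · exact (integrable_ballOverlap hn hab hu0).sub hI

end Layers

/-! ### Layer-cake formula for the energy -/

section Potential

variable {n : ℕ} {W : Space n → ℝ} {w : ℝ → ℝ}

lemma IsAttractivePotential.contDiffOn_profile (hn : 1 ≤ n) (hW : IsAttractivePotential W w) :
    ContDiffOn ℝ ∞ w (Ioi 0) := by
  have : Nonempty (Fin n) := ⟨⟨0, hn⟩⟩
  obtain ⟨e, he⟩ := exists_norm_eq (Space n) (zero_le_one (α := ℝ))
  have he0 : e ≠ 0 := norm_pos_iff.1 (by rw [he]; exact one_pos)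
  have hcomp : ContDiffOn ℝ ∞ (fun r : ℝ => W (r • e)) (Ioi 0) := by
    refine hW.smooth.comp (ContDiff.contDiffOn (by fun_prop)) fun r hr => ?_
    exact smul_ne_zero (ne_of_gt hr) he0
  refine hcomp.congr fun r hr => ?_
  have hr0 : (0 : ℝ) < r := hr
  rw [hW.radial _ (smul_ne_zero hr0.ne' he0), norm_smul, he, mul_one, Real.norm_eq_abs,
    abs_of_pos hr0]

lemma IsAttractivePotential.continuousOn_deriv (hn : 1 ≤ n) (hW : IsAttractivePotential W w) :
    ContinuousOn (deriv w) (Ioi 0) :=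
  (hW.contDiffOn_profile hn).continuousOn_deriv_of_isOpen isOpen_Ioi (by simp)

lemma IsAttractivePotential.integrableOn_deriv (hn : 1 ≤ n) (hW : IsAttractivePotential W w)
    {a b : ℝ} (ha : 0 < a) : IntegrableOn (deriv w) (Ioc a b) :=
  (((hW.continuousOn_deriv hn).mono fun _ hx => ha.trans_le hx.1).integrableOn_compact
    isCompact_Icc).mono_set Ioc_subset_Icc_self

lemma IsAttractivePotential.setIntegral_deriv (hn : 1 ≤ n) (hW : IsAttractivePotential W w)
    {a b : ℝ} (ha : 0 < a) (hab : a ≤ b) : ∫ u in Ioc a b, deriv w u = w b - w a := by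
  rw [← intervalIntegral.integral_of_le hab]
  refine intervalIntegral.integral_deriv_eq_sub (fun x hx => ?_) ?_
  · rw [uIcc_of_le hab] at hx
    have hx0 : 0 < x := ha.trans_le hx.1
    exact ((hW.contDiffOn_profile hn).contDiffAt (Ioi_mem_nhds hx0)).differentiableAt (by simp)
  · exact (intervalIntegrable_iff_integrableOn_Ioc_of_le hab).2 (hW.integrableOn_deriv hn ha)

/-- The layer-cake kernel of an attractive potential, normalised at distance `1`:
`w r - w 1 = ∫_0^∞ w'(u) (1_{u ≤ r} - 1_{u ≤ 1}) du`. For fixed `r` it has constant sign in `u`, and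
for fixed `u` it has constant sign in `r`. -/
noncomputable def layerKernel (r u : ℝ) : ℝ := (if r < u then 0 else 1) - (if u ≤ 1 then 1 else 0)

lemma layerKernel_nonneg {r u : ℝ} (h : 1 ≤ r ∨ 1 < u) : 0 ≤ layerKernel r u := by
  unfold layerKernel
  split_ifs <;> first | (exfalso; rcases h with h | h <;> linarith) | norm_num

lemma layerKernel_nonpos {r u : ℝ} (h : r ≤ 1 ∨ u ≤ 1) : layerKernel r u ≤ 0 := by
  unfold layerKernel
  split_ifs <;> first | (exfalso; rcases h with h | h <;> linarith) | norm_num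

lemma measurable_layerKernel : Measurable fun q : ℝ × ℝ => layerKernel q.1 q.2 := by
  unfold layerKernel
  exact (Measurable.ite (measurableSet_lt (by fun_prop) (by fun_prop)) (by fun_prop)
    (by fun_prop)).sub (Measurable.ite (measurableSet_le (by fun_prop) (by fun_prop)) (by fun_prop)
    (by fun_prop))

lemma deriv_mul_layerKernel_eq {r u : ℝ} : deriv w u * layerKernel r u
    = (Ioc 1 r).indicator (deriv w) u - (Ioc r 1).indicator (deriv w) u := by
  simp only [layerKernel, indicator, mem_Ioc]
  by_cases h1 : r < u <;> by_cases h2 : u ≤ 1 <;> simp [not_le.2, not_lt.1, *]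

lemma IsAttractivePotential.integrable_layerKernel (hn : 1 ≤ n) (hW : IsAttractivePotential W w)
    {r : ℝ} (hr : 0 < r) : Integrable fun u => deriv w u * layerKernel r u := by
  simp only [deriv_mul_layerKernel_eq]
  exact ((integrable_indicator_iff measurableSet_Ioc).2 (hW.integrableOn_deriv hn one_pos)).sub
    ((integrable_indicator_iff measurableSet_Ioc).2 (hW.integrableOn_deriv hn hr))

lemma IsAttractivePotential.integral_layerKernel (hn : 1 ≤ n) (hW : IsAttractivePotential W w)
    {r : ℝ} (hr : 0 < r) : ∫ u in Ioi 0, deriv w u * layerKernel r u = w r - w 1 := by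
  have hind : ∀ {a b : ℝ}, 0 < a → ∫ u in Ioi 0, (Ioc a b).indicator (deriv w) u
      = ∫ u in Ioc a b, deriv w u := by
    intro a b ha
    rw [setIntegral_indicator measurableSet_Ioc]
    congr 2
    exact inter_eq_right.2 fun x hx => ha.trans hx.1
  simp only [deriv_mul_layerKernel_eq]
  rw [integral_sub, hind one_pos, hind hr]
  · rcases le_total 1 r with h | h
    · rw [hW.setIntegral_deriv hn one_pos h, Ioc_eq_empty (not_lt.2 h)]
      simp
    · rw [hW.setIntegral_deriv hn hr h, Ioc_eq_empty (not_lt.2 h)]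
      simp
  · exact ((integrable_indicator_iff measurableSet_Ioc).2
      (hW.integrableOn_deriv hn one_pos)).integrableOn
  · exact ((integrable_indicator_iff measurableSet_Ioc).2
      (hW.integrableOn_deriv hn hr)).integrableOn

end Potential

section Energy

variable {n : ℕ} {ρ : Space n → ℝ}

lemma IsProbDensity.integrable_pair (hρ : IsProbDensity ρ) :
    Integrable fun p : Space n × Space n => ρ p.1 * ρ p.2 :=
  hρ.integrable.mul_prod hρ.integrable

lemma IsProbDensity.integral_pair (hρ : IsProbDensity ρ) :
    ∫ p : Space n × Space n, ρ p.1 * ρ p.2 = 1 := by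
  rw [Measure.volume_eq_prod, integral_prod_mul, hρ.integral_eq_one, one_mul]

lemma measurableSet_norm_sub_lt (n : ℕ) (u : ℝ) :
    MeasurableSet {p : Space n × Space n | ‖p.1 - p.2‖ < u} :=
  (isOpen_lt (by fun_prop) (by fun_prop)).measurableSet

lemma pair_mul_layerKernel (u : ℝ) (p : Space n × Space n) :
    ρ p.1 * ρ p.2 * layerKernel ‖p.1 - p.2‖ u = (1 - if u ≤ 1 then 1 else 0) * (ρ p.1 * ρ p.2)
      - {p : Space n × Space n | ‖p.1 - p.2‖ < u}.indicator (fun p => ρ p.1 * ρ p.2) p := by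
  simp only [layerKernel, indicator, mem_ofPred_eq]
  split_ifs <;> ring

lemma IsProbDensity.integrable_pair_layerKernel (hρ : IsProbDensity ρ) (u : ℝ) :
    Integrable fun p : Space n × Space n => ρ p.1 * ρ p.2 * layerKernel ‖p.1 - p.2‖ u := by
  simp only [pair_mul_layerKernel]
  exact (hρ.integrable_pair.const_mul _).sub
    (hρ.integrable_pair.indicator (measurableSet_norm_sub_lt n u))

/-- The average of `layerKernel` over pairs: `-pairMass` up to distance `1`, and `1 - pairMass`, the
mass of the pairs at distance at least `u`, beyond. -/
noncomputable def normalizedTail (ρ : Space n → ℝ) (u : ℝ) : ℝ :=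
  (1 - if u ≤ 1 then 1 else 0) - pairMass ρ u

lemma IsProbDensity.integral_pair_layerKernel (hρ : IsProbDensity ρ) (u : ℝ) :
    ∫ p : Space n × Space n, ρ p.1 * ρ p.2 * layerKernel ‖p.1 - p.2‖ u = normalizedTail ρ u := by
  simp only [pair_mul_layerKernel]
  rw [integral_sub (hρ.integrable_pair.const_mul _)
    (hρ.integrable_pair.indicator (measurableSet_norm_sub_lt n u)), integral_const_mul,
    hρ.integral_pair, mul_one]
  rfl

lemma IsProbDensity.normalizedTail_nonneg (hρ : IsProbDensity ρ) {u : ℝ} (hu : 1 < u) :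
    0 ≤ normalizedTail ρ u := by
  rw [← hρ.integral_pair_layerKernel]
  exact integral_nonneg fun p => mul_nonneg (mul_nonneg (hρ.nonneg _) (hρ.nonneg _))
    (layerKernel_nonneg (Or.inr hu))

lemma IsProbDensity.integral_norm_pair_layerKernel (hρ : IsProbDensity ρ) (u : ℝ) :
    ∫ p : Space n × Space n, ‖ρ p.1 * ρ p.2 * layerKernel ‖p.1 - p.2‖ u‖
      = ‖normalizedTail ρ u‖ := by
  rw [← hρ.integral_pair_layerKernel]
  rcases le_or_gt u 1 with hu | hu
  · have h : ∀ p : Space n × Space n, ρ p.1 * ρ p.2 * layerKernel ‖p.1 - p.2‖ u ≤ 0 := fun p =>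
      mul_nonpos_of_nonneg_of_nonpos (mul_nonneg (hρ.nonneg _) (hρ.nonneg _))
        (layerKernel_nonpos (Or.inr hu))
    rw [Real.norm_of_nonpos (integral_nonpos h), ← integral_neg]
    exact integral_congr_ae (Filter.Eventually.of_forall fun p => Real.norm_of_nonpos (h p))
  · have h : ∀ p : Space n × Space n, 0 ≤ ρ p.1 * ρ p.2 * layerKernel ‖p.1 - p.2‖ u := fun p =>
      mul_nonneg (mul_nonneg (hρ.nonneg _) (hρ.nonneg _)) (layerKernel_nonneg (Or.inr hu))
    rw [Real.norm_of_nonneg (integral_nonneg h)]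
    exact integral_congr_ae (Filter.Eventually.of_forall fun p => Real.norm_of_nonneg (h p))

variable {W : Space n → ℝ} {w : ℝ → ℝ}

lemma measurable_pair_deriv_layerKernel (hm : Measurable ρ) :
    Measurable fun q : (Space n × Space n) × ℝ =>
      ρ q.1.1 * ρ q.1.2 * (deriv w q.2 * layerKernel ‖q.1.1 - q.1.2‖ q.2) := by
  have h1 := measurable_layerKernel.comp
    (by fun_prop : Measurable fun q : (Space n × Space n) × ℝ => (‖q.1.1 - q.1.2‖, q.2))
  have h2 := (measurable_deriv w).comp
    (measurable_snd : Measurable (Prod.snd : (Space n × Space n) × ℝ → ℝ))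
  exact (by fun_prop : Measurable fun q : (Space n × Space n) × ℝ => ρ q.1.1 * ρ q.1.2).mul
    (h2.mul h1)

lemma measurable_normalizedTail (hρ : IsProbDensity ρ) (hm : Measurable ρ) :
    Measurable (normalizedTail ρ) := by
  have h1 := measurable_layerKernel.comp
    (by fun_prop : Measurable fun q : (Space n × Space n) × ℝ => (‖q.1.1 - q.1.2‖, q.2))
  have h2 := ((by fun_prop : Measurable fun q : (Space n × Space n) × ℝ =>
    ρ q.1.1 * ρ q.1.2).mul h1).stronglyMeasurable.integral_prod_left'
      (μ := (volume : Measure (Space n × Space n)))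
  simp only [Pi.mul_apply, Function.comp_apply, hρ.integral_pair_layerKernel] at h2
  exact h2.measurable

lemma ae_fst_ne_snd (hn : 1 ≤ n) : ∀ᵐ p : Space n × Space n, p.1 ≠ p.2 := by
  have : Nonempty (Fin n) := ⟨⟨0, hn⟩⟩
  have hm : MeasurableSet {p : Space n × Space n | p.1 = p.2} :=
    (isClosed_eq continuous_fst continuous_snd).measurableSet
  have h : volume {p : Space n × Space n | p.1 = p.2} = 0 := by
    rw [Measure.volume_eq_prod, Measure.measure_prod_null hm]
    refine Filter.Eventually.of_forall fun x => ?_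
    have : Prod.mk x ⁻¹' {p : Space n × Space n | p.1 = p.2} = {x} := by
      ext y; simp [eq_comm]
    simp only [this]
    simp
  simpa [ae_iff] using h

/-- Fubini for the layer-cake formula, as far as integrability is concerned; `S` restricts the
distances. No cancellation occurs in either order of integration, as the sign of the kernel is
constant there. -/
lemma integrable_pair_iff (hn : 1 ≤ n) (hW : IsAttractivePotential W w) (hρ : IsProbDensity ρ)
    (hm : Measurable ρ) {S : Set ℝ} (hS : MeasurableSet S) (hS0 : S ⊆ Ioi 0) :
    (Integrable (fun q : (Space n × Space n) × ℝ =>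
        ρ q.1.1 * ρ q.1.2 * (deriv w q.2 * layerKernel ‖q.1.1 - q.1.2‖ q.2))
        (volume.prod (volume.restrict S)) ↔
      Integrable fun p : Space n × Space n =>
        ρ p.1 * ρ p.2 * ∫ u in S, deriv w u * layerKernel ‖p.1 - p.2‖ u) ∧
    (Integrable (fun q : (Space n × Space n) × ℝ =>
        ρ q.1.1 * ρ q.1.2 * (deriv w q.2 * layerKernel ‖q.1.1 - q.1.2‖ q.2))
        (volume.prod (volume.restrict S)) ↔
      IntegrableOn (fun u => deriv w u * normalizedTail ρ u) S) := by
  have hmeas := measurable_pair_deriv_layerKernel (w := w) hm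
  have hpos : ∀ᵐ u ∂volume.restrict S, 0 < deriv w u := by
    filter_upwards [ae_restrict_mem hS] with u hu
    exact hW.deriv_pos u (hS0 hu)
  constructor
  · rw [integrable_prod_iff hmeas.aestronglyMeasurable]
    have h1 : ∀ᵐ p : Space n × Space n, Integrable (fun u =>
        ρ p.1 * ρ p.2 * (deriv w u * layerKernel ‖p.1 - p.2‖ u)) (volume.restrict S) := by
      filter_upwards [ae_fst_ne_snd hn] with p hp
      exact ((hW.integrable_layerKernel hn
        (norm_pos_iff.2 (sub_ne_zero.2 hp))).integrableOn).const_mul _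
    have h2 : ∀ p : Space n × Space n, ∫ u in S,
        ‖ρ p.1 * ρ p.2 * (deriv w u * layerKernel ‖p.1 - p.2‖ u)‖
        = ‖ρ p.1 * ρ p.2 * ∫ u in S, deriv w u * layerKernel ‖p.1 - p.2‖ u‖ := by
      intro p
      simp only [norm_mul (ρ p.1 * ρ p.2)]
      rw [integral_const_mul]
      congr 1
      rcases le_total 1 ‖p.1 - p.2‖ with hr | hr
      · have h : ∀ᵐ u ∂volume.restrict S, 0 ≤ deriv w u * layerKernel ‖p.1 - p.2‖ u := by
          filter_upwards [hpos] with u hu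
          exact mul_nonneg hu.le (layerKernel_nonneg (Or.inl hr))
        rw [Real.norm_of_nonneg (integral_nonneg_of_ae h)]
        exact integral_congr_ae (h.mono fun u hu => Real.norm_of_nonneg hu)
      · have h : ∀ᵐ u ∂volume.restrict S, deriv w u * layerKernel ‖p.1 - p.2‖ u ≤ 0 := by
          filter_upwards [hpos] with u hu
          exact mul_nonpos_of_nonneg_of_nonpos hu.le (layerKernel_nonpos (Or.inl hr))
        rw [Real.norm_of_nonpos (integral_nonpos_of_ae h), ← integral_neg]
        exact integral_congr_ae (h.mono fun u hu => Real.norm_of_nonpos hu)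
    have h3 : AEStronglyMeasurable (fun p : Space n × Space n =>
        ρ p.1 * ρ p.2 * ∫ u in S, deriv w u * layerKernel ‖p.1 - p.2‖ u) volume := by
      have := hmeas.stronglyMeasurable.integral_prod_right' (ν := volume.restrict S)
      simpa only [integral_const_mul] using this.aestronglyMeasurable
    simp only [h2, h1, true_and]
    exact integrable_norm_iff h3
  · rw [integrable_prod_iff' hmeas.aestronglyMeasurable]
    have hcomm : ∀ (p : Space n × Space n) (u : ℝ),
        ρ p.1 * ρ p.2 * (deriv w u * layerKernel ‖p.1 - p.2‖ u)
        = deriv w u * (ρ p.1 * ρ p.2 * layerKernel ‖p.1 - p.2‖ u) := fun p u => by ring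
    have h1 : ∀ᵐ u ∂volume.restrict S, Integrable (fun p : Space n × Space n =>
        ρ p.1 * ρ p.2 * (deriv w u * layerKernel ‖p.1 - p.2‖ u)) := by
      refine Filter.Eventually.of_forall fun u => ?_
      simp only [hcomm]
      exact (hρ.integrable_pair_layerKernel u).const_mul _
    have h2 : ∀ u : ℝ, ∫ p : Space n × Space n,
        ‖ρ p.1 * ρ p.2 * (deriv w u * layerKernel ‖p.1 - p.2‖ u)‖
        = ‖deriv w u * normalizedTail ρ u‖ := by
      intro u
      simp only [hcomm, norm_mul (deriv w u)]
      rw [integral_const_mul, hρ.integral_norm_pair_layerKernel]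
    have h3 : AEStronglyMeasurable (fun u => deriv w u * normalizedTail ρ u)
        (volume.restrict S) :=
      ((measurable_deriv w).mul (measurable_normalizedTail hρ hm)).aestronglyMeasurable
    simp only [h2, h1, true_and]
    exact integrable_norm_iff h3

lemma pairMass_le (hρ : IsProbDensity ρ) {M : ℝ} (hM : ∀ x, ρ x ≤ M) {u : ℝ}
    (hu : 0 < u) : pairMass ρ u ≤ M * (unitBallVolume n * u ^ n) := by
  have hM0 : 0 ≤ M := (hρ.nonneg 0).trans (hM 0)
  have hS := measurableSet_norm_sub_lt n u
  have hind := hρ.integrable_pair.indicator hS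
  rw [pairMass, Measure.volume_eq_prod, integral_prod _ hind]
  have hball : ∀ x : Space n, volume.real (Metric.ball x u) = unitBallVolume n * u ^ n := by
    intro x
    rw [measureReal_def, Measure.addHaar_ball_of_pos _ _ hu, ENNReal.toReal_mul,
      ENNReal.toReal_ofReal (by positivity), finrank_euclideanSpace, Fintype.card_fin, mul_comm]
    rfl
  calc _ ≤ ∫ x, ρ x * (M * (unitBallVolume n * u ^ n)) := by
        refine integral_mono_of_nonneg ?_ (hρ.integrable.mul_const _) ?_
        · exact Filter.Eventually.of_forall fun x => integral_nonneg fun y => indicator_nonneg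
            (fun p _ => mul_nonneg (hρ.nonneg _) (hρ.nonneg _)) _
        · refine Filter.Eventually.of_forall fun x => ?_
          have hle : ∀ y, {p : Space n × Space n | ‖p.1 - p.2‖ < u}.indicator
              (fun p => ρ p.1 * ρ p.2) (x, y)
              ≤ (Metric.ball x u).indicator (fun _ => ρ x * M) y := by
            intro y
            simp only [indicator, mem_ofPred_eq, Metric.mem_ball, dist_comm y x, dist_eq_norm]
            split_ifs
            · exact mul_le_mul_of_nonneg_left (hM y) (hρ.nonneg x)
            · exact le_rfl
          have hint : Integrable ((Metric.ball x u).indicator fun _ : Space n => ρ x * M) :=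
            (integrable_indicator_iff measurableSet_ball).2
              (integrableOn_const measure_ball_lt_top.ne)
          refine (integral_mono_of_nonneg ?_ hint (Filter.Eventually.of_forall hle)).trans ?_
          · exact Filter.Eventually.of_forall fun y => indicator_nonneg
              (fun p _ => mul_nonneg (hρ.nonneg _) (hρ.nonneg _)) _
          · rw [integral_indicator_const _ measurableSet_ball, hball, smul_eq_mul]
            apply le_of_eq; ring
    _ = M * (unitBallVolume n * u ^ n) := by
        rw [integral_mul_const, hρ.integral_eq_one, one_mul]

lemma pairMass_nonneg (hρ : IsProbDensity ρ) (u : ℝ) : 0 ≤ pairMass ρ u :=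
  integral_nonneg fun p => indicator_nonneg (fun _ _ => mul_nonneg (hρ.nonneg _) (hρ.nonneg _)) p

/-- Short distances contribute a finite amount to the energy of a bounded density. -/
lemma integrableOn_short (hW : IsAttractivePotential W w)
    (hWsing : NoMoreSingularThanRiesz n w) (hρ : IsProbDensity ρ) (hm : Measurable ρ) {M : ℝ}
    (hM : ∀ x, ρ x ≤ M) : IntegrableOn (fun u => deriv w u * normalizedTail ρ u) (Ioc 0 1) := by
  obtain ⟨k, C, hk, hC, hle⟩ := hWsing
  have hM0 : 0 ≤ M := (hρ.nonneg 0).trans (hM 0)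
  have hc := unitBallVolume_pos n
  rw [integrableOn_Ioc_iff_integrableOn_Ioo]
  have hpow : IntegrableOn (fun u : ℝ => C * (M * unitBallVolume n) * u ^ (k - 1 + n)) (Ioo 0 1) := by
    have := intervalIntegral.intervalIntegrable_rpow' (a := 0) (b := 1) (r := k - 1 + n)
      (by linarith)
    rw [intervalIntegrable_iff_integrableOn_Ioo_of_le zero_le_one] at this
    exact this.const_mul _
  refine Integrable.mono' hpow ?_ ?_
  · exact ((measurable_deriv w).mul (measurable_normalizedTail hρ hm)).aestronglyMeasurable
  · filter_upwards [ae_restrict_mem measurableSet_Ioo] with u hu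
    have hP := pairMass_le hρ hM hu.1
    have hP0 := pairMass_nonneg hρ u
    have hT : normalizedTail ρ u = -pairMass ρ u := by
      simp [normalizedTail, hu.2.le]
    rw [hT, norm_mul, norm_neg, Real.norm_of_nonneg (hW.deriv_pos u hu.1).le,
      Real.norm_of_nonneg hP0]
    calc deriv w u * pairMass ρ u ≤ C * u ^ (k - 1) * (M * (unitBallVolume n * u ^ n)) :=
          mul_le_mul (hle u hu.1 hu.2) hP hP0 (mul_nonneg hC.le (Real.rpow_nonneg hu.1.le _))
      _ = C * (M * unitBallVolume n) * u ^ (k - 1 + n) := by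
          rw [Real.rpow_add hu.1, Real.rpow_natCast]; ring

lemma ae_potential_eq (hn : 1 ≤ n) (hW : IsAttractivePotential W w) :
    ∀ᵐ p : Space n × Space n, W (p.1 - p.2)
      = w 1 + ∫ u in Ioi 0, deriv w u * layerKernel ‖p.1 - p.2‖ u := by
  filter_upwards [ae_fst_ne_snd hn] with p hp
  have h0 := sub_ne_zero.2 hp
  rw [hW.integral_layerKernel hn (norm_pos_iff.2 h0), hW.radial _ h0]
  ring

lemma ae_energyDensity_eq (hn : 1 ≤ n) (hW : IsAttractivePotential W w) :
    (fun p : Space n × Space n => ρ p.1 * W (p.1 - p.2) * ρ p.2) =ᵐ[volume]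
      fun p => w 1 * (ρ p.1 * ρ p.2)
        + ρ p.1 * ρ p.2 * ∫ u in Ioi 0, deriv w u * layerKernel ‖p.1 - p.2‖ u := by
  filter_upwards [ae_potential_eq hn hW] with p hp
  rw [hp]; ring

lemma hasFiniteEnergy_iff (hn : 1 ≤ n) (hW : IsAttractivePotential W w) (hρ : IsProbDensity ρ)
    (hm : Measurable ρ) : HasFiniteEnergy W ρ ↔
      IntegrableOn (fun u => deriv w u * normalizedTail ρ u) (Ioi 0) := by
  obtain ⟨h1, h2⟩ := integrable_pair_iff hn hW hρ hm measurableSet_Ioi subset_rfl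
  rw [HasFiniteEnergy, integrable_congr (ae_energyDensity_eq hn hW), ← h2, h1]
  exact integrable_add_iff_integrable_right (hρ.integrable_pair.const_mul (w 1))

/-- Fubini for the layer-cake formula. -/
lemma interactionEnergy_eq (hn : 1 ≤ n) (hW : IsAttractivePotential W w) (hρ : IsProbDensity ρ)
    (hm : Measurable ρ) (hfin : HasFiniteEnergy W ρ) : interactionEnergy W ρ
      = (1 / 2) * (w 1 + ∫ u in Ioi 0, deriv w u * normalizedTail ρ u) := by
  obtain ⟨h1, h2⟩ := integrable_pair_iff hn hW hρ hm measurableSet_Ioi subset_rfl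
  have hint := (hasFiniteEnergy_iff hn hW hρ hm).1 hfin
  have hH := h2.2 hint
  have hP := h1.1 hH
  have hiter : ∫ x, ρ x * ∫ y, W (x - y) * ρ y
      = ∫ p : Space n × Space n, ρ p.1 * W (p.1 - p.2) * ρ p.2 := by
    rw [Measure.volume_eq_prod, integral_prod _ hfin]
    simp only [← integral_const_mul, mul_assoc]
  rw [interactionEnergy, hiter, integral_congr_ae (ae_energyDensity_eq hn hW),
    integral_add (hρ.integrable_pair.const_mul _) hP, integral_const_mul, hρ.integral_pair, mul_one]
  congr 2
  have hswap := integral_integral_swap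
    (f := fun (p : Space n × Space n) (u : ℝ) =>
      ρ p.1 * ρ p.2 * (deriv w u * layerKernel ‖p.1 - p.2‖ u)) hH
  simp only [integral_const_mul] at hswap
  rw [hswap]
  refine integral_congr_ae (Filter.Eventually.of_forall fun u => ?_)
  have hcomm : ∀ (p : Space n × Space n) (u : ℝ),
      ρ p.1 * ρ p.2 * (deriv w u * layerKernel ‖p.1 - p.2‖ u)
      = deriv w u * (ρ p.1 * ρ p.2 * layerKernel ‖p.1 - p.2‖ u) := fun p u => by ring
  simp only [hcomm, integral_const_mul, hρ.integral_pair_layerKernel]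

lemma energyWellDefined_of_bounded (hn : 1 ≤ n) (hW : IsAttractivePotential W w)
    (hWsing : NoMoreSingularThanRiesz n w) (hρ : IsProbDensity ρ) (hm : Measurable ρ) {M : ℝ}
    (hM : ∀ x, ρ x ≤ M) : EnergyWellDefined W ρ := by
  obtain ⟨h1, h2⟩ := integrable_pair_iff hn hW hρ hm measurableSet_Ioc
    (Ioc_subset_Ioi_self : Ioc (0 : ℝ) 1 ⊆ Ioi 0)
  obtain ⟨g1, -⟩ := integrable_pair_iff hn hW hρ hm measurableSet_Ioi subset_rfl
  have hshort := h1.1 (h2.2 (integrableOn_short hW hWsing hρ hm hM))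
  have hmeas : AEStronglyMeasurable (fun p : Space n × Space n => ρ p.1 * W (p.1 - p.2) * ρ p.2)
      volume := by
    refine AEStronglyMeasurable.congr ?_ (ae_energyDensity_eq hn hW).symm
    refine hρ.integrable_pair.aestronglyMeasurable.const_mul _ |>.add ?_
    have := (measurable_pair_deriv_layerKernel (w := w) hm).stronglyMeasurable.integral_prod_right'
      (ν := volume.restrict (Ioi (0 : ℝ)))
    simpa only [integral_const_mul] using this.aestronglyMeasurable
  refine Integrable.mono' ((hρ.integrable_pair.const_mul |w 1|).add hshort.norm)
    (hmeas.neg.sup aestronglyMeasurable_const) ?_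
  filter_upwards [ae_energyDensity_eq (ρ := ρ) hn hW, ae_fst_ne_snd hn] with p hp hne
  have hr : 0 < ‖p.1 - p.2‖ := norm_pos_iff.2 (sub_ne_zero.2 hne)
  have hρρ : 0 ≤ ρ p.1 * ρ p.2 := mul_nonneg (hρ.nonneg _) (hρ.nonneg _)
  -- beyond distance `1` the kernel is nonnegative
  have hsplit : ∫ u in Ioc 0 1, deriv w u * layerKernel ‖p.1 - p.2‖ u
      ≤ ∫ u in Ioi 0, deriv w u * layerKernel ‖p.1 - p.2‖ u := by
    have hI := hW.integrable_layerKernel hn hr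
    rw [← Ioc_union_Ioi_eq_Ioi (zero_le_one (α := ℝ)), setIntegral_union (Ioc_disjoint_Ioi le_rfl)
      measurableSet_Ioi hI.integrableOn hI.integrableOn, le_add_iff_nonneg_right]
    refine setIntegral_nonneg measurableSet_Ioi fun u hu => ?_
    exact mul_nonneg (hW.deriv_pos u (one_pos.trans hu)).le (layerKernel_nonneg (Or.inr hu))
  have h3 := mul_le_mul_of_nonneg_left hsplit hρρ
  have h4 := neg_abs_le (ρ p.1 * ρ p.2 * ∫ u in Ioc 0 1, deriv w u * layerKernel ‖p.1 - p.2‖ u)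
  have h5 := mul_le_mul_of_nonneg_right (neg_abs_le (w 1)) hρρ
  rw [Real.norm_of_nonneg (le_max_right _ _), hp]
  simp only [Pi.add_apply, Real.norm_eq_abs]
  have h6 : 0 ≤ |w 1| * (ρ p.1 * ρ p.2) := by positivity
  refine max_le ?_ (by positivity)
  linarith

end Energy

/-! ### Convexity along the interpolation -/

section Convexity

variable {n : ℕ} {W : Space n → ℝ} {w : ℝ → ℝ} {a b : ℝ → ℝ}

lemma normalizedTail_convex (hn : 1 ≤ n) (ha : IsHeightSlope a) (hb : IsHeightSlope b)
    {s t : ℝ} (hs : 0 < s) (ht : 0 < t) (hst : s + t = 1) {u : ℝ} (hu : 0 < u) :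
    normalizedTail (layeredDensity n fun r => s * a r + t * b r) u
      ≤ s * normalizedTail (layeredDensity n a) u + t * normalizedTail (layeredDensity n b) u := by
  have := pairMass_concave hn ha hb hs ht hst hu
  unfold normalizedTail
  have ht' : t = 1 - s := by linarith
  subst ht'
  linarith

lemma energyWellDefined_layeredDensity (hn : 1 ≤ n) (hW : IsAttractivePotential W w)
    (hWsing : NoMoreSingularThanRiesz n w) (ha : IsHeightSlope a) :
    EnergyWellDefined W (layeredDensity n a) :=
  energyWellDefined_of_bounded hn hW hWsing (isProbDensity_layeredDensity hn ha)
    (measurable_layeredDensity ha) (layeredDensity_le ha)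

lemma hasFiniteEnergy_combination (hn : 1 ≤ n) (hW : IsAttractivePotential W w)
    (hWsing : NoMoreSingularThanRiesz n w) (ha : IsHeightSlope a) (hb : IsHeightSlope b)
    {s t : ℝ} (hs : 0 < s) (ht : 0 < t) (hst : s + t = 1)
    (hfa : HasFiniteEnergy W (layeredDensity n a)) (hfb : HasFiniteEnergy W (layeredDensity n b)) :
    HasFiniteEnergy W (layeredDensity n fun r => s * a r + t * b r) := by
  have hab := ha.combination hb hs.le ht.le hst
  have hρ := isProbDensity_layeredDensity hn hab
  have hm := measurable_layeredDensity (n := n) hab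
  have ia := (hasFiniteEnergy_iff hn hW (isProbDensity_layeredDensity hn ha)
    (measurable_layeredDensity ha)).1 hfa
  have ib := (hasFiniteEnergy_iff hn hW (isProbDensity_layeredDensity hn hb)
    (measurable_layeredDensity hb)).1 hfb
  rw [hasFiniteEnergy_iff hn hW hρ hm, ← Ioc_union_Ioi_eq_Ioi (zero_le_one (α := ℝ))]
  refine (integrableOn_short hW hWsing hρ hm (layeredDensity_le hab)).union ?_
  have hsub : Ioi (1 : ℝ) ⊆ Ioi 0 := Ioi_subset_Ioi zero_le_one
  refine Integrable.mono' (((ia.mono_set hsub).const_mul s).add ((ib.mono_set hsub).const_mul t))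
    ?_ ?_
  · exact ((measurable_deriv w).mul (measurable_normalizedTail hρ hm)).aestronglyMeasurable
  · filter_upwards [ae_restrict_mem measurableSet_Ioi] with u hu
    have hu0 : (0 : ℝ) < u := one_pos.trans hu
    have hw := hW.deriv_pos u hu0
    have h := mul_le_mul_of_nonneg_left (normalizedTail_convex hn ha hb hs ht hst hu0) hw.le
    rw [Real.norm_of_nonneg (mul_nonneg hw.le (hρ.normalizedTail_nonneg hu))]
    simp only [Pi.add_apply]
    linarith

lemma interactionEnergy_combination_lt (hn : 1 ≤ n) (hW : IsAttractivePotential W w)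
    (hWsing : NoMoreSingularThanRiesz n w) (ha : IsHeightSlope a) (hb : IsHeightSlope b)
    {s t : ℝ} (hs : 0 < s) (ht : 0 < t) (hst : s + t = 1)
    (hne : ¬ ∀ᵐ r ∂volume.restrict (Ioo (0 : ℝ) 1), a r = b r)
    (hfa : HasFiniteEnergy W (layeredDensity n a)) (hfb : HasFiniteEnergy W (layeredDensity n b)) :
    interactionEnergy W (layeredDensity n fun r => s * a r + t * b r)
      < s * interactionEnergy W (layeredDensity n a)
        + t * interactionEnergy W (layeredDensity n b) := by
  have hab := ha.combination hb hs.le ht.le hst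
  have ha' := isProbDensity_layeredDensity hn ha
  have hb' := isProbDensity_layeredDensity hn hb
  have hab' := isProbDensity_layeredDensity hn hab
  have ma := measurable_layeredDensity (n := n) ha
  have mb := measurable_layeredDensity (n := n) hb
  have mab := measurable_layeredDensity (n := n) hab
  have hfab := hasFiniteEnergy_combination hn hW hWsing ha hb hs ht hst hfa hfb
  have ia := (hasFiniteEnergy_iff hn hW ha' ma).1 hfa
  have ib := (hasFiniteEnergy_iff hn hW hb' mb).1 hfb
  have iab := (hasFiniteEnergy_iff hn hW hab' mab).1 hfab
  rw [interactionEnergy_eq hn hW ha' ma hfa, interactionEnergy_eq hn hW hb' mb hfb,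
    interactionEnergy_eq hn hW hab' mab hfab]
  have isum : IntegrableOn (fun u => s * (deriv w u * normalizedTail (layeredDensity n a) u)
      + t * (deriv w u * normalizedTail (layeredDensity n b) u)) (Ioi 0) :=
    (ia.const_mul s).add (ib.const_mul t)
  have key : 0 < ∫ u in Ioi 0, (s * (deriv w u * normalizedTail (layeredDensity n a) u)
      + t * (deriv w u * normalizedTail (layeredDensity n b) u)
      - deriv w u * normalizedTail (layeredDensity n fun r => s * a r + t * b r) u) := by
    obtain ⟨α, hα, hstrict⟩ := exists_pairMass_strictConcave hn ha hb hs ht hst hne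
    rw [setIntegral_pos_iff_support_of_nonneg_ae ?_ ?_]
    · refine (show 0 < volume (Ioo (α / 2) (2 * α)) by
        rw [Real.volume_Ioo, ENNReal.ofReal_pos]; linarith).trans_le (measure_mono fun u hu => ?_)
      have hu0 : 0 < u := by linarith [hu.1]
      refine ⟨ne_of_gt ?_, hu0⟩
      have h : normalizedTail (layeredDensity n fun r => s * a r + t * b r) u
          < s * normalizedTail (layeredDensity n a) u
            + t * normalizedTail (layeredDensity n b) u := by
        have := hstrict u hu
        unfold normalizedTail
        have ht' : t = 1 - s := by linarith
        subst ht'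
        linarith
      have := mul_lt_mul_of_pos_left h (hW.deriv_pos u hu0)
      linarith
    · filter_upwards [ae_restrict_mem measurableSet_Ioi] with u hu
      have h := mul_le_mul_of_nonneg_left (normalizedTail_convex hn ha hb hs ht hst hu)
        (hW.deriv_pos u hu).le
      simp only [Pi.zero_apply]
      linarith
    · exact isum.sub iab
  rw [integral_sub isum iab, integral_add (ia.const_mul s) (ib.const_mul t), integral_const_mul,
    integral_const_mul] at key
  have ht' : t = 1 - s := by linarith
  subst ht'
  linarith

end Convexity

/-- A height slope which represents the derivative of the height function of `ρ`: the value at the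
null set of points where the derivative is not positive is replaced by `1`. -/
noncomputable def heightSlope {n : ℕ} (ρ : Space n → ℝ) (s : ℝ) : ℝ :=
  if 0 < deriv (heightFunction ρ) s then deriv (heightFunction ρ) s else 1

section Slope

variable {n : ℕ} {ρ : Space n → ℝ}

lemma heightSlope_ae_eq (hρ : IsProbDensity ρ) (hcont : Continuous ρ)
    (hdec : RadiallyDecreasing ρ) : ∀ᵐ s ∂volume.restrict (Ioo (0 : ℝ) 1),
      HasDerivAt (heightFunction ρ) (heightSlope ρ s) s := by
  filter_upwards [ae_hasDerivAt_heightFunction hρ hcont hdec] with s hs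
  rw [heightSlope, if_pos hs.2]
  exact hs.1

lemma isHeightSlope_heightSlope (hρ : IsProbDensity ρ) (hcont : Continuous ρ)
    (hdec : RadiallyDecreasing ρ) : IsHeightSlope (heightSlope ρ) where
  measurable := Measurable.ite (measurableSet_lt measurable_const (measurable_deriv _))
    (measurable_deriv _) measurable_const
  pos s := by
    unfold heightSlope
    split_ifs with h
    · exact h
    · exact one_pos
  integrable := by
    refine (integrableOn_deriv_heightFunction hρ hdec).congr ?_
    filter_upwards [heightSlope_ae_eq hρ hcont hdec] with s hs
    exact hs.deriv

end Slope

/-- The height slope of the density at time `t` of the interpolation curve. -/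
noncomputable def interpolatedSlope {n : ℕ} (ρ₀ ρ₁ : Space n → ℝ) (t s : ℝ) : ℝ :=
  (1 - t) * heightSlope ρ₀ s + t * heightSlope ρ₁ s

lemma heightInterpolation_eq {n : ℕ} {ρ₀ ρ₁ : Space n → ℝ}
    (hρ₀ : IsProbDensity ρ₀) (hρ₁ : IsProbDensity ρ₁)
    (hcont₀ : Continuous ρ₀) (hcont₁ : Continuous ρ₁)
    (hdec₀ : RadiallyDecreasing ρ₀) (hdec₁ : RadiallyDecreasing ρ₁) (t : ℝ) :
    heightInterpolation ρ₀ ρ₁ t = layeredDensity n (interpolatedSlope ρ₀ ρ₁ t) := by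
  refine layeredDensity_congr ?_
  filter_upwards [heightSlope_ae_eq hρ₀ hcont₀ hdec₀, heightSlope_ae_eq hρ₁ hcont₁ hdec₁]
    with s h₀ h₁
  exact ((h₀.const_mul (1 - t)).add (h₁.const_mul t)).deriv

theorem proposition4p6 {n : ℕ} (hn : 1 ≤ n)
    (W : Space n → ℝ) (w : ℝ → ℝ)
    (hW : IsAttractivePotential W w) (hWsing : NoMoreSingularThanRiesz n w)
    (ρ₀ ρ₁ : Space n → ℝ)
    (hρ₀ : IsProbDensity ρ₀) (hρ₁ : IsProbDensity ρ₁)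
    (hcont₀ : Continuous ρ₀) (hcont₁ : Continuous ρ₁)
    (hdec₀ : RadiallyDecreasing ρ₀) (hdec₁ : RadiallyDecreasing ρ₁)
    (hne : ρ₀ ≠ ρ₁) :
    (∀ t ∈ Icc (0 : ℝ) 1, EnergyWellDefined W (heightInterpolation ρ₀ ρ₁ t)) ∧
    StrictConvexOn ℝ {t ∈ Icc (0 : ℝ) 1 | HasFiniteEnergy W (heightInterpolation ρ₀ ρ₁ t)}
      (fun t => interactionEnergy W (heightInterpolation ρ₀ ρ₁ t)) := by
  have hs₀ := isHeightSlope_heightSlope hρ₀ hcont₀ hdec₀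
  have hs₁ := isHeightSlope_heightSlope hρ₁ hcont₁ hdec₁
  simp only [heightInterpolation_eq hρ₀ hρ₁ hcont₀ hcont₁ hdec₀ hdec₁]
  have hslope : ∀ t ∈ Icc (0 : ℝ) 1, IsHeightSlope (interpolatedSlope ρ₀ ρ₁ t) := fun t ht =>
    hs₀.combination hs₁ (sub_nonneg.2 ht.2) ht.1 (by ring)
  have haffine : ∀ {x y s t : ℝ}, s + t = 1 → interpolatedSlope ρ₀ ρ₁ (s • x + t • y)
      = fun r => s * interpolatedSlope ρ₀ ρ₁ x r + t * interpolatedSlope ρ₀ ρ₁ y r := by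
    intro x y s t hst
    funext r
    have ht' : t = 1 - s := by linarith
    subst ht'
    simp only [interpolatedSlope, smul_eq_mul]
    ring
  refine ⟨fun t ht => energyWellDefined_layeredDensity hn hW hWsing (hslope t ht), ?_, ?_⟩
  · rw [convex_iff_forall_pos]
    intro x hx y hy s t hs ht hst
    refine ⟨convex_Icc 0 1 hx.1 hy.1 hs.le ht.le hst, ?_⟩
    rw [haffine hst]
    exact hasFiniteEnergy_combination hn hW hWsing (hslope x hx.1) (hslope y hy.1) hs ht hst
      hx.2 hy.2
  · intro x hx y hy hxy s t hs ht hst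
    simp only [haffine hst]
    refine interactionEnergy_combination_lt hn hW hWsing (hslope x hx.1) (hslope y hy.1) hs ht hst
      (fun hae => hne ?_) hx.2 hy.2
    refine eq_of_deriv_heightFunction_ae_eq hn hρ₀ hρ₁ hcont₀ hcont₁ hdec₀ hdec₁ ?_
    filter_upwards [hae, heightSlope_ae_eq hρ₀ hcont₀ hdec₀,
      heightSlope_ae_eq hρ₁ hcont₁ hdec₁] with r hr h₀ h₁
    rw [h₀.deriv, h₁.deriv]
    unfold interpolatedSlope at hr
    have : (y - x) * (heightSlope ρ₀ r - heightSlope ρ₁ r) = 0 := by linarith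
    rcases mul_eq_zero.1 this with h | h
    · exact absurd (by linarith) hxy
    · linarith
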